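/- Let $X(1)=\mathrm{SL}_2(\mathbb Z)\backslash\mathbb H\cup\{\infty\}$, $X=X(1)\times X(1)$, and let $D=\{\infty\}\times X(1)+X(1)\times\{\infty\}$ be the boundary divisor. Local coordinates on $X$ are, in each factor, $z_i\in\mathbb H$ or, at the cusp, $q_i=e^{2\pi i z_i}$ with $|q_i|<1$; smoothness and local equations on $X$ are understood in these uniformizing charts. Put $y_i=\operatorname{Im} z_i$. For an integer $m\neq 0$ let $L_m$ be the set of integral $2\times2$ matrices of determinant $m$, and let $T(m)$ be the divisor on $X$ that is the closure of the image of $\{(z_1,z_2)\in\mathbb H^2:\ z_1=\gamma z_2 \text{ for some }\gamma\in L_m\}$ (with multiplicity one along each branch in the charts; empty for $m<0$). For $v>0$ and $z=(z_1,z_2)\in\mathbb H^2\setminus T(m)$, Kudla's Green function is $$\Xi(v,z,m)=\frac12\sum_{M=\left(\begin{smallmatrix}a&b\\c&d\end{smallmatrix}\right)\in L_m}\int_1^\infty e^{-2\pi v R(z,M)r}\,\frac{dr}{r},\qquad R(z,M)=\frac{|a-bz_2-cz_1+dz_1z_2|^2}{2y_1y_2}.$$ A function $g$ on $X$ is a Green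 function for $T(m)$ in the sense of Gillet–Soulé if for every local equation $f$ of $T(m)$ on an open set, $g+\log|f|^2$ extends to a smooth function there. It is a Green function for $T(m)$ with log-log singularities along $D$ in the sense of Burgos–Kramer–Kühn if for every local equation $f$ of $T(m)$, the function $g+\log|f|^2$ extends to a function $h$ that is smooth off $D$ and pre-log-log along $D$. This means that $h,\partial h,\bar\partial h,\partial\bar\partial h$ have log-log growth: near each point, the coefficients with respect to $\frac{dq_i}{|q_i|\log(1/|q_i|)}$, $\frac{d\bar q_i}{|q_i|\log(1/|q_i|)}$ (for the components $q_i=0$ of $D$ through the point) and the differentials of the other coordinates are bounded by $C\prod_i(\log\log(1/|q_i|))^M$ for some $C$ and $M$, the product running over the components $q_i=0$ of $D$ through the point. Then for every $m\ne0$ and every $v>0$: 1. The series $\Xi(v,z,m)$ converges for all $z\in\mathbb H^2\setminus T(m)$, and $\Xi(v,\cdot,m)$ descends to a function on $X\setminus(D\cup T(m))$. 2. $\Xi(v,\cdot,m)$ does not descend to a Green function for $T(m)$ on $X$ in the sense of Gillet–Soulé. 3. $\Xi(v,\cdot,m)$ does not descend to a Green function for $T(m)$ on $X$ with log-log singularities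 along $D$ in the sense of Burgos–Kramer–Kühn. 4. The boundary behaviour contains a term of order $t=\sqrt{y_1y_2}$: there are an open neighbourhood $W$ of $(q_1,q_2)=(0,0)$, a local equation $f$ of $T(m)$ on $W$, and real numbers $a,c>0$ and $T_0$ such that for all $z\in\mathbb H^2$ with $y_1=a y_2$ and $y_2\ge T_0$ one has $(q_1,q_2)\in W$, $z\notin T(m)$ and $$\bigl|\Xi(v,z,m)+\log|f(q_1,q_2)|^2\bigr|\ \ge\ c\,\sqrt{y_1y_2}.$$ -/

import Mathlib

open scoped Topology ContDiff

noncomputable section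

namespace KudlaGreen

/-! ## The modular surface `X = X(1) × X(1)` -/

/-- The open modular curve `SL₂(ℤ) \ ℍ`. -/
abbrev Y1 : Type :=
  MulAction.orbitRel.Quotient (Matrix.SpecialLinearGroup (Fin 2) ℤ) UpperHalfPlane

/-- The compact modular curve `X(1) = SL₂(ℤ) \ ℍ ∪ {∞}`. -/
abbrev X1 : Type := OnePoint Y1

/-- The compact modular surface `X = X(1) × X(1)`; the two coordinates are `0` and `1`. -/
abbrev X : Type := Fin 2 → X1

/-- The quotient map `ℍ → X(1)`. -/
def proj1 (z : UpperHalfPlane) : X1 :=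
  OnePoint.some (Quotient.mk (MulAction.orbitRel _ _) z : Y1)

/-- The quotient map `ℍ × ℍ → X`. -/
def proj (z : Fin 2 → UpperHalfPlane) : X := fun i => proj1 (z i)

/-- The local uniformizer `q = e^{2πiz}` of `X(1)` at the cusp: the point `q ≠ 0` of the open
unit disc is sent to the class of any `z ∈ ℍ` with `e^{2πiz} = q`, and `0` to `∞`. -/
def cuspChart (q : ℂ) : X1 :=
  if q = 0 then OnePoint.infty
  else proj1 (UpperHalfPlane.ofComplex (Function.Periodic.invQParam 1 q))

/-- The uniformizing charts of `X`. They are indexed by the set `S` of the coordinates in which the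
cuspidal coordinate `q_i` is used; in the other coordinates the coordinate is `z_i ∈ ℍ`. -/
def chart (S : Finset (Fin 2)) (w : Fin 2 → ℂ) : X := fun i =>
  if i ∈ S then cuspChart (w i) else proj1 (UpperHalfPlane.ofComplex (w i))

/-- The domain of `chart S`: `|q_i| < 1` for `i ∈ S` and `Im z_i > 0` for `i ∉ S`. -/
def chartDomain (S : Finset (Fin 2)) : Set (Fin 2 → ℂ) :=
  {w | ∀ i, if i ∈ S then ‖w i‖ < 1 else 0 < (w i).im}

/-- The boundary divisor `D = {∞} × X(1) + X(1) × {∞}` in `chart S`. -/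
def chartBoundary (S : Finset (Fin 2)) : Set (Fin 2 → ℂ) :=
  {w | ∃ i ∈ S, w i = 0}

/-! ## The Hecke correspondence `T(m)` -/

/-- The integral `2 × 2`-matrices of determinant `m`. -/
abbrev L (m : ℤ) : Type := {M : Matrix (Fin 2) (Fin 2) ℤ // M.det = m}

/-- `T(m) ⊂ ℍ × ℍ`: the points with `z₁ = γ z₂`, that is `z₁ (c z₂ + d) = a z₂ + b`, for some
integral matrix `γ = (a b; c d)` of determinant `m`. -/
def heckeSet (m : ℤ) : Set (Fin 2 → UpperHalfPlane) :=
  {z | ∃ γ : L m, (z 0 : ℂ) * ((γ.1 1 0 : ℂ) * (z 1 : ℂ) + (γ.1 1 1 : ℂ)) =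
    (γ.1 0 0 : ℂ) * (z 1 : ℂ) + (γ.1 0 1 : ℂ)}

/-- The part over `X ∖ D` of the curve `T(m)`, in `chart S`. -/
def chartHecke (m : ℤ) (S : Finset (Fin 2)) : Set (Fin 2 → ℂ) :=
  {w | w ∈ chartDomain S ∧ chart S w ∈ proj '' heckeSet m}

/-- `f` is a local equation, on the open subset `W` of the domain of `chart S`, of the divisor
`T(m)` on `X`, the closure of its part over `X ∖ D`. All multiplicities of this divisor are one (in
uniformizing charts), so a local equation is a holomorphic function with zero set `T(m)` that
vanishes to first order along a dense part of it. -/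
structure IsLocalEquation (m : ℤ) (S : Finset (Fin 2)) (W : Set (Fin 2 → ℂ))
    (f : (Fin 2 → ℂ) → ℂ) : Prop where
  isOpen : IsOpen W
  subset : W ⊆ chartDomain S
  holomorphic : DifferentiableOn ℂ f W
  zeros : ∀ w ∈ W, f w = 0 ↔ w ∈ closure (chartHecke m S)
  reduced : W ∩ closure (chartHecke m S) ⊆ closure {w | w ∈ W ∧ f w = 0 ∧ fderiv ℂ f w ≠ 0}

/-! ## Green functions on `X` -/

/-- Green functions for `T(m)` on `X` in the sense of Gillet and Soulé: for every local equation
`f` of `T(m)`, the function `g + log |f|²` extends to a smooth function. (The values of `g` on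
`T(m)` play no role.) -/
def IsGreen (m : ℤ) (g : X → ℝ) : Prop :=
  ∀ (S : Finset (Fin 2)) (W : Set (Fin 2 → ℂ)) (f : (Fin 2 → ℂ) → ℂ), IsLocalEquation m S W f →
    ∃ h : (Fin 2 → ℂ) → ℝ, ContDiffOn ℝ ∞ h W ∧
      ∀ w ∈ W, f w ≠ 0 → g (chart S w) = -Real.log (‖f w‖ ^ 2) + h w

/-- The Wirtinger derivative `∂F/∂w_i`. -/
def dz (i : Fin 2) (F : (Fin 2 → ℂ) → ℂ) (w : Fin 2 → ℂ) : ℂ :=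
  (1 / 2) * (fderiv ℝ F w (Pi.single i 1) - Complex.I * fderiv ℝ F w (Pi.single i Complex.I))

/-- The Wirtinger derivative `∂F/∂w̄_i`. -/
def dzbar (i : Fin 2) (F : (Fin 2 → ℂ) → ℂ) (w : Fin 2 → ℂ) : ℂ :=
  (1 / 2) * (fderiv ℝ F w (Pi.single i 1) + Complex.I * fderiv ℝ F w (Pi.single i Complex.I))

/-- The indices of the components of `D` that pass through the point `p` of `chart S`. -/
def cuspsAt (S : Finset (Fin 2)) (p : Fin 2 → ℂ) : Finset (Fin 2) :=
  S.filter (fun i => p i = 0)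

/-- The function `F` has log-log growth along `D` at the point `p` of `chart S`: near `p` and off
`D`, it is bounded by a constant times `∏ (log log (1 / |q_i|)) ^ M`, the product being taken over
the components `q_i = 0` of `D` through `p`. -/
def LogLogGrowthAt (S : Finset (Fin 2)) (p : Fin 2 → ℂ) (F : (Fin 2 → ℂ) → ℂ) : Prop :=
  ∃ (C : ℝ) (M : ℕ), ∀ᶠ w in 𝓝[(chartBoundary S)ᶜ] p,
    ‖F w‖ ≤ C * ∏ i ∈ cuspsAt S p, Real.log (Real.log (1 / ‖w i‖)) ^ M

/-- The factor `ρ_i` such that `dw_i / ρ_i` is the `i`-th generator of the forms of log-log growth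
at `p`: it is `|q_i| log (1 / |q_i|)` if `q_i = 0` is a component of `D` through `p`, and `1`
otherwise. -/
def weight (S : Finset (Fin 2)) (p : Fin 2 → ℂ) (i : Fin 2) (w : Fin 2 → ℂ) : ℝ :=
  if i ∈ cuspsAt S p then ‖w i‖ * Real.log (1 / ‖w i‖) else 1

/-- The function `h` on the open subset `W` of the domain of `chart S` is pre-log-log along `D`:
it is smooth off `D`, and `h`, `∂h`, `∂̄h` and `∂∂̄h` have log-log growth along `D`. Here
`∑ u_i dw_i` has log-log growth if all `ρ_i u_i` have, and so on. -/
structure IsPreLogLog (S : Finset (Fin 2)) (W : Set (Fin 2 → ℂ)) (h : (Fin 2 → ℂ) → ℝ) : Prop where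
  smooth : ContDiffOn ℝ ∞ h (W \ chartBoundary S)
  growth : ∀ p ∈ W, LogLogGrowthAt S p (fun w => (h w : ℂ))
  growth_del : ∀ p ∈ W, ∀ i, LogLogGrowthAt S p
    (fun w => (weight S p i w : ℂ) * dz i (fun w => (h w : ℂ)) w)
  growth_delbar : ∀ p ∈ W, ∀ i, LogLogGrowthAt S p
    (fun w => (weight S p i w : ℂ) * dzbar i (fun w => (h w : ℂ)) w)
  growth_del_delbar : ∀ p ∈ W, ∀ i j, LogLogGrowthAt S p
    (fun w => (weight S p i w : ℂ) * (weight S p j w : ℂ) *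
      dz i (dzbar j (fun w => (h w : ℂ))) w)

/-- Green functions for `T(m)` on `X` with log-log singularities along `D` in the sense of Burgos,
Kramer and Kühn: for every local equation `f` of `T(m)`, the function `g + log |f|²` extends from
the complement of `T(m)` and `D` to a function that is pre-log-log along `D`. -/
def IsLogLogGreen (m : ℤ) (g : X → ℝ) : Prop :=
  ∀ (S : Finset (Fin 2)) (W : Set (Fin 2 → ℂ)) (f : (Fin 2 → ℂ) → ℂ), IsLocalEquation m S W f →
    ∃ h : (Fin 2 → ℂ) → ℝ, IsPreLogLog S W h ∧
      ∀ w ∈ W, w ∉ chartBoundary S → f w ≠ 0 → g (chart S w) = -Real.log (‖f w‖ ^ 2) + h w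

/-! ## Kudla's Green function -/

/-- `R(z, M) = |a - b z₂ - c z₁ + d z₁ z₂|² / (2 y₁ y₂)` for `M = (a b; c d)`. -/
def R (z : Fin 2 → UpperHalfPlane) (M : Matrix (Fin 2) (Fin 2) ℤ) : ℝ :=
  ‖(M 0 0 : ℂ) - (M 0 1 : ℂ) * (z 1 : ℂ) - (M 1 0 : ℂ) * (z 0 : ℂ)
    + (M 1 1 : ℂ) * (z 0 : ℂ) * (z 1 : ℂ)‖ ^ 2 / (2 * (z 0).im * (z 1).im)

/-- `-Ei(-x) = ∫₁^∞ e^{-xr} dr / r` for `x > 0`. -/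
def negEiNeg (x : ℝ) : ℝ := ∫ r in Set.Ioi (1 : ℝ), Real.exp (-x * r) / r

/-- Kudla's Green function `Ξ(v, z, m) = (1/2) ∑_{det M = m} -Ei(-2πv R(z, M))`. -/
def Xi (v : ℝ) (m : ℤ) (z : Fin 2 → UpperHalfPlane) : ℝ :=
  (1 / 2) * ∑' M : L m, negEiNeg (2 * Real.pi * v * R z M.1)

/-- The function `g` on `X` is a descent of `Ξ(v, ·, m)`, which is a function on the complement of
`T(m)` in `ℍ × ℍ`. The values of `g` on `D` are not restricted. -/
def IsDescentOfXi (v : ℝ) (m : ℤ) (g : X → ℝ) : Prop :=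
  ∀ z, z ∉ heckeSet m → g (proj z) = Xi v m z

/-- The cuspidal coordinates `(q₁, q₂) = (e^{2πi z₁}, e^{2πi z₂})`. -/
def qCoord (z : Fin 2 → UpperHalfPlane) : Fin 2 → ℂ :=
  fun i => Function.Periodic.qParam 1 (z i : ℂ)

end KudlaGreen

end

/-! Write `y₁`, `y₂` for the imaginary parts of `z 0`, `z 1`, and `M = (a b; c d)`. By
`two_mul_R_add`, `2R + 2m` is a positive definite quadratic form in the entries of `M`, so `Ξ` is
dominated by a fourfold theta series and converges. The action of `SL₂(ℤ) × SL₂(ℤ)` only permutes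
the terms (`R_smul`), so `Ξ` descends.

Everything else happens near `(∞, ∞)`. Matrices with `d ≠ 0` have `2R ≥ y₁y₂ - 2m` and contribute a
bounded amount on a fixed ray `y₁ = A y₂`, high enough up. If `d = 0`, then `bc = -m` leaves
finitely many `(b, c)`, but `a` is free and enters `R` only through `(a - s)² / (2y₁y₂)`. About
`√(y₁y₂)` values of `a` matter, which gives a term of that order. On a ray, `log log (1/|q_i|) = log
(2πy_i)`, so its powers are negligible against `√(y₁y₂)`. Hence a single ray on which `|Ξ + log
|f|²|` grows linearly excludes both notions of Green function (`not_logLogGrowthAt`).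

For `m < 0` the local equation is `f = 1` and the diagonal ray works (`le_Xi_of_neg`). For `m > 0`,
`f = ∏ (q₁^d - q₂^a)` over `ad = m`, and `log |f|² ≤ 2 log 2 - 4πy₂` on steep rays. There `d = 0`
forces `R ≥ A/8`, so `Ξ` is at most a constant times `exp(-πvA/4) √A y₂`, plus a bounded term
(`Xi_le`). For large `A` it cannot cancel `log |f|²`. -/

namespace KudlaGreen

open MeasureTheory Filter
open scoped ENNReal

/-! ## Theta series -/

/-- The theta series `∑ exp (-k n²)`. -/
noncomputable def thetaSum (k : ℝ) : ℝ≥0∞ := ∑' n : ℤ, ENNReal.ofReal (Real.exp (-k * (n : ℝ) ^ 2))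

lemma summable_exp_neg_mul_int_sq {k : ℝ} (hk : 0 < k) :
    Summable fun n : ℤ => Real.exp (-k * (n : ℝ) ^ 2) := by
  have h : Summable fun n : ℕ => Real.exp (-k * (n : ℝ) ^ 2) := by
    refine Summable.of_nonneg_of_le (fun n => (Real.exp_pos _).le) (fun n => ?_)
      (Real.summable_exp_nat_mul_iff.mpr (neg_lt_zero.mpr hk))
    rw [Real.exp_le_exp]
    have : (n : ℝ) ≤ (n : ℝ) ^ 2 := by exact_mod_cast Nat.le_self_pow two_ne_zero n
    nlinarith
  exact Summable.of_nat_of_neg (by simpa using h) (by simpa using h)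

lemma thetaSum_ne_top {k : ℝ} (hk : 0 < k) : thetaSum k ≠ ⊤ :=
  (summable_exp_neg_mul_int_sq hk).tsum_ofReal_ne_top

lemma thetaSum_anti {k l : ℝ} (h : k ≤ l) : thetaSum l ≤ thetaSum k := by
  refine ENNReal.tsum_le_tsum fun n => ENNReal.ofReal_le_ofReal (Real.exp_le_exp.mpr ?_)
  nlinarith [sq_nonneg (n : ℝ)]

/-- A bound for shifted theta series that is uniform in the shift. -/
lemma tsum_exp_shift_le {k : ℝ} (hk : 0 ≤ k) (s : ℝ) :
    ∑' n : ℤ, ENNReal.ofReal (Real.exp (-k * ((n : ℝ) - s) ^ 2)) ≤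
      ENNReal.ofReal (Real.exp k) * thetaSum (k / 2) := by
  rw [thetaSum, ← ENNReal.tsum_mul_left,
    ← (Equiv.addRight ⌊s⌋).tsum_eq fun n : ℤ =>
      ENNReal.ofReal (Real.exp (-k * ((n : ℝ) - s) ^ 2))]
  refine ENNReal.tsum_le_tsum fun n => ?_
  rw [← ENNReal.ofReal_mul (Real.exp_pos _).le, ← Real.exp_add]
  refine ENNReal.ofReal_le_ofReal (Real.exp_le_exp.mpr ?_)
  simp only [Equiv.coe_addRight, Int.cast_add]
  have h1 := Int.floor_le s
  have h2 := Int.lt_floor_add_one s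
  -- With `u ∈ [0, 1)` the fractional part of `s`, the difference of the two sides is `(n - 2u)²/2 +
  -- 1 - u²`.
  have h3 : (n : ℝ) ^ 2 / 2 ≤ ((n : ℝ) + ⌊s⌋ - s) ^ 2 + 1 := by
    nlinarith [sq_nonneg ((n : ℝ) - 2 * (s - ⌊s⌋))]
  nlinarith [mul_le_mul_of_nonneg_left h3 hk]

/-- Theta inversion: the dual series has parameter `π²/k ≥ π`, so it is at most its value at `π`.
Applied with `k` proportional to `1/(y₁y₂)`, the factor `√(π/k)` is the source of `√(y₁y₂)`. -/
lemma thetaSum_le {k : ℝ} (hk : 0 < k) (hk' : k ≤ Real.pi) :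
    thetaSum k ≤ ENNReal.ofReal (√(Real.pi / k)) * thetaSum Real.pi := by
  have hπ := Real.pi_pos
  have key := Real.tsum_exp_neg_mul_int_sq (div_pos hk hπ)
  have e1 : ∀ n : ℤ, -Real.pi * (k / Real.pi) * (n : ℝ) ^ 2 = -k * (n : ℝ) ^ 2 := fun n => by
    field_simp
  have e2 : ∀ n : ℤ, -Real.pi / (k / Real.pi) * (n : ℝ) ^ 2 = -(Real.pi ^ 2 / k) * (n : ℝ) ^ 2 :=
    fun n => by field_simp
  simp only [e1, e2] at key
  have hpos : 0 < Real.pi ^ 2 / k := by positivity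
  rw [thetaSum, ← ENNReal.ofReal_tsum_of_nonneg (fun _ => (Real.exp_pos _).le)
    (summable_exp_neg_mul_int_sq hk), key, ENNReal.ofReal_mul (by positivity)]
  gcongr
  · rw [← Real.sqrt_eq_rpow, one_div, ← Real.sqrt_inv, inv_div]
  · rw [ENNReal.ofReal_tsum_of_nonneg (fun _ => (Real.exp_pos _).le)
      (summable_exp_neg_mul_int_sq hpos)]
    refine thetaSum_anti ?_
    rw [le_div_iff₀ hk]
    nlinarith

/-! ## The exponential integral -/

lemma integrableOn_exp_neg_mul {x : ℝ} (hx : 0 < x) :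
    IntegrableOn (fun r : ℝ => Real.exp (-x * r)) (Set.Ioi 1) :=
  integrableOn_exp_mul_Ioi (neg_lt_zero.mpr hx) 1

lemma integrableOn_exp_neg_mul_div {x : ℝ} (hx : 0 < x) :
    IntegrableOn (fun r : ℝ => Real.exp (-x * r) / r) (Set.Ioi 1) := by
  refine (integrableOn_exp_neg_mul hx).mono' ?_ ?_
  · exact (Measurable.aestronglyMeasurable (by fun_prop))
  · refine (ae_restrict_iff' measurableSet_Ioi).mpr (.of_forall fun r (hr : 1 < r) => ?_)
    rw [Real.norm_of_nonneg (by positivity)]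
    exact div_le_self (Real.exp_pos _).le hr.le

lemma negEiNeg_nonneg (x : ℝ) : 0 ≤ negEiNeg x :=
  setIntegral_nonneg measurableSet_Ioi fun r (hr : 1 < r) => by positivity

lemma negEiNeg_le {x : ℝ} (hx : 1 ≤ x) : negEiNeg x ≤ Real.exp (-x) := by
  have hx0 : 0 < x := by linarith
  calc negEiNeg x ≤ ∫ r in Set.Ioi (1 : ℝ), Real.exp (-x * r) :=
        setIntegral_mono_on (integrableOn_exp_neg_mul_div hx0) (integrableOn_exp_neg_mul hx0)
          measurableSet_Ioi fun r (hr : 1 < r) => div_le_self (Real.exp_pos _).le hr.le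
    _ = Real.exp (-x) / x := by
        rw [integral_exp_mul_Ioi (neg_lt_zero.mpr hx0), mul_one, neg_div_neg_eq]
    _ ≤ Real.exp (-x) := div_le_self (Real.exp_pos _).le hx

lemma negEiNeg_anti {x y : ℝ} (hx : 0 < x) (h : x ≤ y) : negEiNeg y ≤ negEiNeg x := by
  refine setIntegral_mono_on (integrableOn_exp_neg_mul_div (hx.trans_le h))
    (integrableOn_exp_neg_mul_div hx) measurableSet_Ioi fun r (hr : 1 < r) => ?_
  have : -y * r ≤ -x * r := by nlinarith
  have := Real.exp_le_exp.mpr this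
  gcongr

lemma negEiNeg_pos {x : ℝ} (hx : 0 < x) : 0 < negEiNeg x := by
  refine (setIntegral_pos_iff_support_of_nonneg_ae ?_ (integrableOn_exp_neg_mul_div hx)).mpr ?_
  · refine (ae_restrict_iff' measurableSet_Ioi).mpr (.of_forall fun r (hr : 1 < r) => ?_)
    simp only [Pi.zero_apply]
    positivity
  · refine lt_of_lt_of_le ?_ (measure_mono (s := Set.Ioi (1 : ℝ)) fun r (hr : 1 < r) => ⟨?_, hr⟩)
    · simp
    · simp only [Function.mem_support]
      positivity

/-! ## The quadratic form `R` -/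

/-- `R(z, M)` in terms of the positive definite majorant of the determinant. -/
lemma two_mul_R_add (z : Fin 2 → UpperHalfPlane) (M : Matrix (Fin 2) (Fin 2) ℤ) :
    2 * R z M + 2 * (M.det : ℝ) =
      ((M 0 0 : ℝ) - (M 0 1 * (z 1).re + M 1 0 * (z 0).re - M 1 1 * (z 0).re * (z 1).re)) ^ 2
          / ((z 0).im * (z 1).im)
        + ((M 0 1 : ℝ) - M 1 1 * (z 0).re) ^ 2 * ((z 1).im / (z 0).im)
        + ((M 1 0 : ℝ) - M 1 1 * (z 1).re) ^ 2 * ((z 0).im / (z 1).im)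
        + (M 1 1 : ℝ) ^ 2 * ((z 0).im * (z 1).im) := by
  have h0 : (z 0).im ≠ 0 := (z 0).im_ne_zero
  have h1 : (z 1).im ≠ 0 := (z 1).im_ne_zero
  rw [R, Complex.sq_norm, Complex.normSq_apply, Matrix.det_fin_two]
  simp only [Complex.sub_re, Complex.add_re, Complex.sub_im, Complex.add_im, Complex.mul_re,
    Complex.mul_im, Complex.intCast_re, Complex.intCast_im, UpperHalfPlane.coe_re,
    UpperHalfPlane.coe_im, Int.cast_sub, Int.cast_mul]
  field_simp
  ring

lemma R_nonneg (z : Fin 2 → UpperHalfPlane) (M : Matrix (Fin 2) (Fin 2) ℤ) : 0 ≤ R z M := by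
  have := (z 0).im_pos
  have := (z 1).im_pos
  unfold R
  positivity

lemma R_eq_zero_iff (z : Fin 2 → UpperHalfPlane) (M : Matrix (Fin 2) (Fin 2) ℤ) :
    R z M = 0 ↔ (M 0 0 : ℂ) - (M 0 1 : ℂ) * (z 1 : ℂ) - (M 1 0 : ℂ) * (z 0 : ℂ)
      + (M 1 1 : ℂ) * (z 0 : ℂ) * (z 1 : ℂ) = 0 := by
  have h0 : (z 0).im ≠ 0 := (z 0).im_ne_zero
  have h1 : (z 1).im ≠ 0 := (z 1).im_ne_zero
  simp [R, h0, h1]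

/-- `T(m)` is the zero set of the functions `R(·, M)`. -/
lemma mem_heckeSet_iff (m : ℤ) (z : Fin 2 → UpperHalfPlane) :
    z ∈ heckeSet m ↔ ∃ M : L m, R z M.1 = 0 := by
  simp only [R_eq_zero_iff]
  constructor
  · rintro ⟨⟨γ, hγ⟩, h⟩
    -- This is `γ · (0 1; -1 0)`, which has the same determinant; the converse below multiplies by
    -- the inverse.
    refine ⟨⟨!![-γ 0 1, γ 0 0; -γ 1 1, γ 1 0], ?_⟩, ?_⟩
    · rw [← hγ, Matrix.det_fin_two_of, Matrix.det_fin_two]; ring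
    · simp only [Matrix.of_apply, Matrix.cons_val', Matrix.cons_val_zero, Matrix.cons_val_one,
        Matrix.cons_val_fin_one]
      push_cast
      linear_combination h
  · rintro ⟨⟨M, hM⟩, h⟩
    refine ⟨⟨!![M 0 1, -M 0 0; M 1 1, -M 1 0], ?_⟩, ?_⟩
    · rw [← hM, Matrix.det_fin_two_of, Matrix.det_fin_two]; ring
    · simp only [Matrix.of_apply, Matrix.cons_val', Matrix.cons_val_zero, Matrix.cons_val_one,
        Matrix.cons_val_fin_one]
      push_cast
      linear_combination h

/-! ## Convergence -/

lemma exp_neg_R {m : ℤ} (v : ℝ) (z : Fin 2 → UpperHalfPlane) (M : L m) :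
    Real.exp (-(2 * Real.pi * v * R z M.1)) = Real.exp (2 * Real.pi * v * m) *
      (Real.exp (-(Real.pi * v / ((z 0).im * (z 1).im)) * ((M.1 0 0 : ℝ) -
          (M.1 0 1 * (z 1).re + M.1 1 0 * (z 0).re - M.1 1 1 * (z 0).re * (z 1).re)) ^ 2) *
        (Real.exp (-(Real.pi * v * ((z 1).im / (z 0).im)) *
            ((M.1 0 1 : ℝ) - M.1 1 1 * (z 0).re) ^ 2) *
          (Real.exp (-(Real.pi * v * ((z 0).im / (z 1).im)) *
            ((M.1 1 0 : ℝ) - M.1 1 1 * (z 1).re) ^ 2) *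
          Real.exp (-(Real.pi * v * ((z 0).im * (z 1).im)) * (M.1 1 1 : ℝ) ^ 2)))) := by
  have h := two_mul_R_add z M.1
  rw [M.2] at h
  simp only [← Real.exp_add]
  congr 1
  linear_combination (-(Real.pi * v)) * h

/-- Here `p = (d, c, b)`. The sums over `b` and `c` are shifted theta series with shifts depending
on `d`; since `tsum_exp_shift_le` is uniform in the shift, they factor out. -/
lemma tsum_three_le {k₁ k₂ : ℝ} (h₁ : 0 ≤ k₁) (h₂ : 0 ≤ k₂) (k₃ x₁ x₂ : ℝ) :
    ∑' p : ℤ × ℤ × ℤ, ENNReal.ofReal (Real.exp (-k₁ * ((p.2.2 : ℝ) - p.1 * x₁) ^ 2) *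
      (Real.exp (-k₂ * ((p.2.1 : ℝ) - p.1 * x₂) ^ 2) * Real.exp (-k₃ * (p.1 : ℝ) ^ 2))) ≤
    ENNReal.ofReal (Real.exp k₁) * thetaSum (k₁ / 2) *
      (ENNReal.ofReal (Real.exp k₂) * thetaSum (k₂ / 2) * thetaSum k₃) := by
  simp only [ENNReal.ofReal_mul (Real.exp_pos _).le, ENNReal.tsum_prod', ENNReal.tsum_mul_right]
  rw [thetaSum.eq_def k₃, ← ENNReal.tsum_mul_left, ← ENNReal.tsum_mul_left]
  refine ENNReal.tsum_le_tsum fun d => ?_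
  calc _ ≤ ∑' c : ℤ, ENNReal.ofReal (Real.exp k₁) * thetaSum (k₁ / 2) *
        (ENNReal.ofReal (Real.exp (-k₂ * ((c : ℝ) - d * x₂) ^ 2)) *
          ENNReal.ofReal (Real.exp (-k₃ * (d : ℝ) ^ 2))) :=
        ENNReal.tsum_le_tsum fun c => mul_le_mul_left (tsum_exp_shift_le h₁ _) _
    _ ≤ _ := by
        rw [ENNReal.tsum_mul_left, ENNReal.tsum_mul_right]
        gcongr
        exact tsum_exp_shift_le h₂ _

lemma summable_four {k₀ k₁ k₂ k₃ : ℝ} (h₀ : 0 < k₀) (h₁ : 0 < k₁) (h₂ : 0 < k₂) (h₃ : 0 < k₃)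
    (x₁ x₂ : ℝ) (s : ℤ × ℤ × ℤ → ℝ) :
    Summable fun p : (ℤ × ℤ × ℤ) × ℤ => Real.exp (-k₀ * ((p.2 : ℝ) - s p.1) ^ 2) *
      (Real.exp (-k₁ * ((p.1.2.2 : ℝ) - p.1.1 * x₁) ^ 2) *
        (Real.exp (-k₂ * ((p.1.2.1 : ℝ) - p.1.1 * x₂) ^ 2) *
          Real.exp (-k₃ * (p.1.1 : ℝ) ^ 2))) := by
  have hfin : ∑' p : (ℤ × ℤ × ℤ) × ℤ, ENNReal.ofReal (Real.exp (-k₀ * ((p.2 : ℝ) - s p.1) ^ 2) *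
      (Real.exp (-k₁ * ((p.1.2.2 : ℝ) - p.1.1 * x₁) ^ 2) *
        (Real.exp (-k₂ * ((p.1.2.1 : ℝ) - p.1.1 * x₂) ^ 2) *
          Real.exp (-k₃ * (p.1.1 : ℝ) ^ 2)))) ≠ ⊤ := by
    rw [ENNReal.tsum_prod']
    refine ne_top_of_le_ne_top (b := ENNReal.ofReal (Real.exp k₀) * thetaSum (k₀ / 2) *
      (ENNReal.ofReal (Real.exp k₁) * thetaSum (k₁ / 2) *
      (ENNReal.ofReal (Real.exp k₂) * thetaSum (k₂ / 2) * thetaSum k₃))) ?_ ?_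
    · refine ENNReal.mul_ne_top (ENNReal.mul_ne_top ENNReal.ofReal_ne_top
        (thetaSum_ne_top (by positivity))) (ENNReal.mul_ne_top (ENNReal.mul_ne_top
        ENNReal.ofReal_ne_top (thetaSum_ne_top (by positivity))) (ENNReal.mul_ne_top
        (ENNReal.mul_ne_top ENNReal.ofReal_ne_top (thetaSum_ne_top (by positivity)))
        (thetaSum_ne_top h₃)))
    · grw [← tsum_three_le h₁.le h₂.le k₃ x₁ x₂, ← ENNReal.tsum_mul_left]
      refine ENNReal.tsum_le_tsum fun p => ?_
      dsimp only
      simp_rw [ENNReal.ofReal_mul (Real.exp_pos (-k₀ * _)).le]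
      rw [ENNReal.tsum_mul_right]
      gcongr
      exact tsum_exp_shift_le h₀.le (s p)
  refine (ENNReal.summable_toReal hfin).congr fun p => ENNReal.toReal_ofReal ?_
  positivity

lemma L_ext {m : ℤ} {M N : L m} (h00 : M.1 0 0 = N.1 0 0) (h01 : M.1 0 1 = N.1 0 1)
    (h10 : M.1 1 0 = N.1 1 0) (h11 : M.1 1 1 = N.1 1 1) : M = N := by
  apply Subtype.ext
  ext i j
  fin_cases i <;> fin_cases j <;> assumption

lemma summable_exp_neg_R {v : ℝ} (hv : 0 < v) (m : ℤ) (z : Fin 2 → UpperHalfPlane) :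
    Summable fun M : L m => Real.exp (-(2 * Real.pi * v * R z M.1)) := by
  have hy0 := (z 0).im_pos
  have hy1 := (z 1).im_pos
  have hπ := Real.pi_pos
  simp only [exp_neg_R]
  refine Summable.mul_left _ ?_
  have h := summable_four (k₀ := Real.pi * v / ((z 0).im * (z 1).im))
    (k₁ := Real.pi * v * ((z 1).im / (z 0).im)) (k₂ := Real.pi * v * ((z 0).im / (z 1).im))
    (k₃ := Real.pi * v * ((z 0).im * (z 1).im)) (by positivity) (by positivity) (by positivity)
    (by positivity) (z 0).re (z 1).re
    fun p => p.2.2 * (z 1).re + p.2.1 * (z 0).re - p.1 * (z 0).re * (z 1).re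
  exact h.comp_injective (i := fun M : L m => ((M.1 1 1, M.1 1 0, M.1 0 1), M.1 0 0)) fun M N e => by
    simp only [Prod.mk.injEq] at e
    exact L_ext e.2 e.1.2.2 e.1.2.1 e.1.1

lemma summable_negEiNeg {v : ℝ} (hv : 0 < v) (m : ℤ) (z : Fin 2 → UpperHalfPlane) :
    Summable fun M : L m => negEiNeg (2 * Real.pi * v * R z M.1) := by
  have h := summable_exp_neg_R hv m z
  refine h.of_norm_bounded_eventually ?_
  -- All but finitely many terms have argument larger than `1`, where `negEiNeg_le` applies.
  have h1 := h.tendsto_cofinite_zero.eventually (gt_mem_nhds (Real.exp_pos (-1)))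
  filter_upwards [h1] with M hM
  rw [Real.norm_of_nonneg (negEiNeg_nonneg _)]
  exact negEiNeg_le (by linarith [Real.exp_lt_exp.mp hM])

/-! ## Bounds near the point `(∞, ∞)` -/

lemma R_ge_of_ne_zero {m : ℤ} (z : Fin 2 → UpperHalfPlane) (M : L m) (hd : M.1 1 1 ≠ 0) :
    (z 0).im * (z 1).im ≤ 2 * R z M.1 + 2 * m := by
  have hy0 := (z 0).im_pos
  have hy1 := (z 1).im_pos
  have h := two_mul_R_add z M.1
  rw [M.2] at h
  have hd2 : (1 : ℝ) ≤ (M.1 1 1 : ℝ) ^ 2 := by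
    have : 0 < (M.1 1 1) ^ 2 := by positivity
    exact_mod_cast this
  rw [h]
  have : (z 0).im * (z 1).im ≤ (M.1 1 1 : ℝ) ^ 2 * ((z 0).im * (z 1).im) :=
    le_mul_of_one_le_left (by positivity) hd2
  refine this.trans (le_add_of_nonneg_left ?_)
  positivity

lemma mul_eq_of_eq_zero {m : ℤ} (M : L m) (hd : M.1 1 1 = 0) : M.1 0 1 * M.1 1 0 = -m := by
  have := M.2
  rw [Matrix.det_fin_two, hd] at this
  linarith

/-- As `bc = -m`, the two mixed squares of `two_mul_R_add` and `-2m` combine to `(b + cA)²/A = b²/A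
+ c²A - 2m`. Since `c ≠ 0`, this is at least `A - 2m ≥ A/2`. The linear growth in `A` makes `Ξ`
small on steep rays. -/
lemma R_ge_of_eq_zero {m : ℤ} (hm : m ≠ 0) {A : ℝ} (hA : 1 ≤ A) (hAm : 4 * |(m : ℝ)| ≤ A)
    (z : Fin 2 → UpperHalfPlane) (hz : (z 0).im = A * (z 1).im) (M : L m) (hd : M.1 1 1 = 0) :
    ((M.1 0 0 : ℝ) - (M.1 0 1 * (z 1).re + M.1 1 0 * (z 0).re)) ^ 2 / ((z 0).im * (z 1).im)
      + A / 4 ≤ 2 * R z M.1 := by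
  have hy1 := (z 1).im_pos
  have h := two_mul_R_add z M.1
  have hbc := mul_eq_of_eq_zero M hd
  have hc : M.1 1 0 ≠ 0 := fun h0 => hm (by simpa [h0] using hbc)
  have hcA : (1 : ℝ) ≤ (M.1 1 0 : ℝ) ^ 2 := by
    have : 0 < (M.1 1 0) ^ 2 := by positivity
    exact_mod_cast this
  have hbc' : (M.1 0 1 : ℝ) * M.1 1 0 = -m := by exact_mod_cast hbc
  rw [M.2, hd, hz] at h
  have e : 2 * R z M.1 = ((M.1 0 0 : ℝ) - (M.1 0 1 * (z 1).re + M.1 1 0 * (z 0).re)) ^ 2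
      / ((z 0).im * (z 1).im) + ((M.1 0 1 : ℝ) + M.1 1 0 * A) ^ 2 / A := by
    rw [hz]
    field_simp at h ⊢
    simp only [Int.cast_zero] at h
    linear_combination h - 2 * A * (z 1).im ^ 2 * hbc'
  rw [e]
  refine add_le_add_right ?_ _
  rw [le_div_iff₀ (by linarith)]
  have hb : 0 ≤ A / 2 - 2 * (m : ℝ) := by linarith [le_abs_self (m : ℝ)]
  nlinarith [mul_nonneg (by linarith : (0 : ℝ) ≤ A) hb, sq_nonneg (M.1 0 1 : ℝ),
    mul_le_mul_of_nonneg_right hcA (sq_nonneg A)]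

lemma two_pi_R_ge_one {v : ℝ} (hv : 0 < v) {m : ℤ} {A : ℝ} (hA : 1 ≤ A)
    {z : Fin 2 → UpperHalfPlane} (hz : (z 0).im = A * (z 1).im)
    (hT : 1 + 2 * |(m : ℝ)| + 1 / (Real.pi * v) ≤ (z 1).im) (M : L m) (hd : M.1 1 1 ≠ 0) :
    1 ≤ 2 * Real.pi * v * R z M.1 := by
  have hπ := Real.pi_pos
  have h := R_ge_of_ne_zero z M hd
  have hpv : 0 < Real.pi * v := by positivity
  have h1 : 0 < 1 / (Real.pi * v) := by positivity
  have hy : 1 ≤ (z 1).im := by linarith [abs_nonneg (m : ℝ)]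
  have h2 : (z 1).im ≤ (z 0).im * (z 1).im := by
    rw [hz]; nlinarith [mul_le_mul hA hy zero_le_one (by linarith)]
  have h3 : 1 / (Real.pi * v) ≤ 2 * R z M.1 := by linarith [le_abs_self (m : ℝ)]
  rw [div_le_iff₀ hpv] at h3
  linarith

/-- For `d ≠ 0` the entry `a` is determined by `(d, c, b)` through `ad - bc = m`, so there is no
free sum over `a`, the one that would grow. The remaining Gaussians have parameters controlled by
`A` alone. -/
lemma tsum_of_ne_zero_le {v : ℝ} (hv : 0 < v) {m : ℤ} {A : ℝ} (hA : 1 ≤ A)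
    {z : Fin 2 → UpperHalfPlane} (hz : (z 0).im = A * (z 1).im)
    (hT : 1 + 2 * |(m : ℝ)| + 1 / (Real.pi * v) ≤ (z 1).im) :
    ∑' M : {M : L m | M.1 1 1 ≠ 0}, ENNReal.ofReal (negEiNeg (2 * Real.pi * v * R z M.1.1)) ≤
      ENNReal.ofReal (Real.exp (2 * Real.pi * v * m)) *
        (ENNReal.ofReal (Real.exp (Real.pi * v * (1 / A))) * thetaSum (Real.pi * v * (1 / A) / 2) *
        (ENNReal.ofReal (Real.exp (Real.pi * v * A)) * thetaSum (Real.pi * v * A / 2) *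
          thetaSum (Real.pi * v * A))) := by
  have hπ := Real.pi_pos
  have hpv : 0 < Real.pi * v := by positivity
  have hA0 : 0 < A := by linarith
  have hy : 1 ≤ (z 1).im := by linarith [abs_nonneg (m : ℝ), one_div_pos.mpr hpv]
  have hq1 : (z 1).im / (z 0).im = 1 / A := by rw [hz]; field_simp
  have hq2 : (z 0).im / (z 1).im = A := by rw [hz]; field_simp
  have hq3 : A ≤ (z 0).im * (z 1).im := by rw [hz]; nlinarith [mul_le_mul hy hy zero_le_one (by linarith)]
  grw [← tsum_three_le (k₁ := Real.pi * v * (1 / A)) (k₂ := Real.pi * v * A) (by positivity)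
    (by positivity) (Real.pi * v * A) (z 0).re (z 1).re]
  have hinj : Function.Injective fun M : {M : L m | M.1 1 1 ≠ 0} =>
      (M.1.1 1 1, M.1.1 1 0, M.1.1 0 1) := by
    rintro ⟨M, hM⟩ ⟨N, hN⟩ h
    simp only [Prod.mk.injEq] at h
    obtain ⟨h11, h10, h01⟩ := h
    refine Subtype.ext (L_ext ?_ h01 h10 h11)
    have h1 := M.2
    have h2 := N.2
    rw [Matrix.det_fin_two] at h1 h2
    rw [h11, h10, h01] at h1
    exact mul_right_cancel₀ (b := N.1 1 1) hN (by linarith)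
  rw [← ENNReal.tsum_mul_left]
  refine le_trans (ENNReal.tsum_le_tsum fun M => ?_)
    (ENNReal.tsum_comp_le_tsum_of_injective hinj _)
  rw [← ENNReal.ofReal_mul (Real.exp_pos _).le]
  refine ENNReal.ofReal_le_ofReal ((negEiNeg_le (two_pi_R_ge_one hv hA hz hT M.1 M.2)).trans ?_)
  rw [exp_neg_R, hq1, hq2]
  refine mul_le_mul_of_nonneg_left ?_ (Real.exp_pos _).le
  -- The Gaussian in `a` is bounded by `1`; in the one in `d`, `y₁y₂` is replaced by the smaller
  -- `A`.
  refine (mul_le_of_le_one_left (by positivity) (Real.exp_le_one_iff.mpr ?_)).trans ?_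
  · have := (z 0).im_pos
    have := (z 1).im_pos
    rw [neg_mul, neg_nonpos]
    positivity
  · gcongr

/-- The finite set of the possible `(b, c)` for the matrices `(a b; c 0)` of determinant `m`. -/
noncomputable def antidiagonalBox (m : ℤ) : Finset (ℤ × ℤ) := Finset.Icc (-|m|) |m| ×ˢ Finset.Icc (-|m|) |m|

lemma mem_antidiagonalBox {m : ℤ} (hm : m ≠ 0) (M : L m) (hd : M.1 1 1 = 0) :
    (M.1 0 1, M.1 1 0) ∈ antidiagonalBox m := by
  have hbc := mul_eq_of_eq_zero M hd
  have h1 : |M.1 0 1| ≤ |m| := Int.le_of_dvd (abs_pos.mpr hm)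
    ((abs_dvd_abs _ _).mpr ⟨-M.1 1 0, by linarith⟩)
  have h2 : |M.1 1 0| ≤ |m| := Int.le_of_dvd (abs_pos.mpr hm)
    ((abs_dvd_abs _ _).mpr ⟨-M.1 0 1, by linarith⟩)
  simp only [antidiagonalBox, Finset.mem_product, Finset.mem_Icc]
  exact ⟨abs_le.mp h1, abs_le.mp h2⟩

lemma tsum_fintype_shift_le {ι : Type*} [Fintype ι] {k : ℝ} (hk : 0 ≤ k) (c : ℝ≥0∞) (s : ι → ℝ) :
    ∑' p : ι × ℤ, c * ENNReal.ofReal (Real.exp (-k * ((p.2 : ℝ) - s p.1) ^ 2)) ≤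
      Fintype.card ι * (c * (ENNReal.ofReal (Real.exp k) * thetaSum (k / 2))) := by
  have h : ∀ p : ι, ∑' n : ℤ, c * ENNReal.ofReal (Real.exp (-k * ((n : ℝ) - s p) ^ 2)) ≤
      c * (ENNReal.ofReal (Real.exp k) * thetaSum (k / 2)) := fun p => by
    rw [ENNReal.tsum_mul_left]
    exact mul_le_mul_right (tsum_exp_shift_le hk _) _
  rw [ENNReal.tsum_prod', tsum_fintype]
  refine (Finset.sum_le_sum fun p _ => h p).trans_eq ?_
  rw [Finset.sum_const, Finset.card_univ, nsmul_eq_mul]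

/-- The growing part: for each of finitely many `(b, c)`, the free entry `a` gives a shifted theta
series whose parameter `πv/(y₁y₂)` tends to `0`. The hypothesis `hAv` brings all arguments into the
range of `negEiNeg_le`. -/
lemma tsum_of_eq_zero_le {v : ℝ} (hv : 0 < v) {m : ℤ} (hm : m ≠ 0) {A : ℝ} (hA : 1 ≤ A)
    (hAm : 4 * |(m : ℝ)| ≤ A) (hAv : 1 ≤ Real.pi * v * (A / 4))
    {z : Fin 2 → UpperHalfPlane} (hz : (z 0).im = A * (z 1).im) :
    ∑' M : {M : L m | M.1 1 1 = 0}, ENNReal.ofReal (negEiNeg (2 * Real.pi * v * R z M.1.1)) ≤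
      (antidiagonalBox m).card * (ENNReal.ofReal (Real.exp (-(Real.pi * v * (A / 4)))) *
        (ENNReal.ofReal (Real.exp (Real.pi * v / ((z 0).im * (z 1).im))) *
          thetaSum (Real.pi * v / ((z 0).im * (z 1).im) / 2))) := by
  have hπ := Real.pi_pos
  have hy0 := (z 0).im_pos
  have hy1 := (z 1).im_pos
  have hpv : 0 < Real.pi * v := by positivity
  set k := Real.pi * v / ((z 0).im * (z 1).im) with hk
  have hk0 : 0 < k := by positivity
  have hinj : Function.Injective fun M : {M : L m | M.1 1 1 = 0} =>
      ((⟨(M.1.1 0 1, M.1.1 1 0), mem_antidiagonalBox hm M.1 M.2⟩, M.1.1 0 0) :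
        antidiagonalBox m × ℤ) := by
    rintro ⟨M, hM⟩ ⟨N, hN⟩ h
    simp only [Prod.mk.injEq, Subtype.mk.injEq] at h
    exact Subtype.ext (L_ext h.2 h.1.1 h.1.2 (hM.trans hN.symm))
  have hF := tsum_fintype_shift_le hk0.le (ENNReal.ofReal (Real.exp (-(Real.pi * v * (A / 4)))))
    fun p : antidiagonalBox m => p.1.1 * (z 1).re + p.1.2 * (z 0).re
  rw [Fintype.card_coe] at hF
  refine le_trans (le_trans (ENNReal.tsum_le_tsum fun M => ?_)
    (ENNReal.tsum_comp_le_tsum_of_injective hinj _)) hF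
  have hR := R_ge_of_eq_zero hm hA hAm z hz M.1 M.2
  set α := ((M.1.1 0 0 : ℝ) - (M.1.1 0 1 * (z 1).re + M.1.1 1 0 * (z 0).re)) with hα
  have hR' : k * α ^ 2 + Real.pi * v * (A / 4) ≤ 2 * Real.pi * v * R z M.1.1 := by
    have := mul_le_mul_of_nonneg_left hR hpv.le
    refine le_trans (le_of_eq ?_) (this.trans_eq (by ring))
    rw [hk]; ring
  have h1 : 1 ≤ 2 * Real.pi * v * R z M.1.1 := by
    have : 0 ≤ k * α ^ 2 := by positivity
    linarith
  rw [← ENNReal.ofReal_mul (Real.exp_pos _).le, ← Real.exp_add]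
  refine ENNReal.ofReal_le_ofReal ((negEiNeg_le h1).trans (Real.exp_le_exp.mpr ?_))
  linarith

/-- Both lower bounds make `R` positive. Geometrically, the branches of `T(m)` near `(∞, ∞)` satisfy
`d y₁ = a y₂` with `ad = m`, so they have slope at most `m`, and a steeper ray misses them. -/
lemma not_mem_heckeSet_of_large {v : ℝ} (hv : 0 < v) {m : ℤ} (hm : m ≠ 0) {A : ℝ} (hA : 1 ≤ A)
    (hAm : 4 * |(m : ℝ)| ≤ A) {z : Fin 2 → UpperHalfPlane} (hz : (z 0).im = A * (z 1).im)
    (hT : 1 + 2 * |(m : ℝ)| + 1 / (Real.pi * v) ≤ (z 1).im) : z ∉ heckeSet m := by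
  rw [mem_heckeSet_iff]
  rintro ⟨M, hM⟩
  by_cases hd : M.1 1 1 = 0
  · have h := R_ge_of_eq_zero hm hA hAm z hz M hd
    have hy0 := (z 0).im_pos
    have hy1 := (z 1).im_pos
    have : 0 ≤ ((M.1 0 0 : ℝ) - (M.1 0 1 * (z 1).re + M.1 1 0 * (z 0).re)) ^ 2 /
      ((z 0).im * (z 1).im) := by positivity
    linarith
  · have h := two_pi_R_ge_one hv hA hz hT M hd
    rw [hM] at h
    linarith

lemma ofReal_Xi_le {v : ℝ} (hv : 0 < v) (m : ℤ) (z : Fin 2 → UpperHalfPlane) :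
    ENNReal.ofReal (Xi v m z) ≤
      ∑' M : {M : L m | M.1 1 1 = 0}, ENNReal.ofReal (negEiNeg (2 * Real.pi * v * R z M.1.1)) +
      ∑' M : {M : L m | M.1 1 1 ≠ 0}, ENNReal.ofReal (negEiNeg (2 * Real.pi * v * R z M.1.1)) := by
  have hs := summable_negEiNeg hv m z
  have h0 : 0 ≤ ∑' M : L m, negEiNeg (2 * Real.pi * v * R z M.1) :=
    tsum_nonneg fun _ => negEiNeg_nonneg _
  have h := ENNReal.summable.tsum_add_tsum_compl (s := {M : L m | M.1 1 1 = 0})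
    (f := fun M : L m => ENNReal.ofReal (negEiNeg (2 * Real.pi * v * R z M.1))) ENNReal.summable
  rw [← ENNReal.ofReal_tsum_of_nonneg (fun _ => negEiNeg_nonneg _) hs] at h
  refine (ENNReal.ofReal_le_ofReal ?_).trans h.ge
  rw [Xi]
  linarith

/-- The constant in `Xi_le`. -/
noncomputable def cuspConst (v : ℝ) (m : ℤ) : ℝ :=
  (antidiagonalBox m).card * Real.exp (Real.pi * v) * √(2 / v) * (thetaSum Real.pi).toReal

/-- Growth of `Ξ` along `y₁ = A y₂`: the coefficient of `√(y₁ y₂)` decays exponentially in `A`. -/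
lemma Xi_le {v : ℝ} (hv : 0 < v) {m : ℤ} (hm : m ≠ 0) {A : ℝ} (hA : 1 ≤ A)
    (hAm : 4 * |(m : ℝ)| ≤ A) (hAv : 1 ≤ Real.pi * v * (A / 4)) :
    ∃ K : ℝ, ∀ z : Fin 2 → UpperHalfPlane, (z 0).im = A * (z 1).im →
      1 + 2 * |(m : ℝ)| + 1 / (Real.pi * v) + v ≤ (z 1).im →
      Xi v m z ≤ cuspConst v m * Real.exp (-(Real.pi * v * (A / 4))) * √((z 0).im * (z 1).im) + K := by
  have hπ := Real.pi_pos
  have hpv : 0 < Real.pi * v := by positivity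
  set B : ℝ≥0∞ := ENNReal.ofReal (Real.exp (2 * Real.pi * v * m)) *
        (ENNReal.ofReal (Real.exp (Real.pi * v * (1 / A))) * thetaSum (Real.pi * v * (1 / A) / 2) *
        (ENNReal.ofReal (Real.exp (Real.pi * v * A)) * thetaSum (Real.pi * v * A / 2) *
          thetaSum (Real.pi * v * A))) with hB
  have hBtop : B ≠ ⊤ := by
    refine ENNReal.mul_ne_top ENNReal.ofReal_ne_top (ENNReal.mul_ne_top (ENNReal.mul_ne_top
      ENNReal.ofReal_ne_top (thetaSum_ne_top (by positivity))) (ENNReal.mul_ne_top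
      (ENNReal.mul_ne_top ENNReal.ofReal_ne_top (thetaSum_ne_top (by positivity)))
      (thetaSum_ne_top (by positivity))))
  have hΘ : thetaSum Real.pi ≠ ⊤ := thetaSum_ne_top hπ
  refine ⟨B.toReal, fun z hz hT => ?_⟩
  have hy0 := (z 0).im_pos
  have hy1 := (z 1).im_pos
  have h1v : 0 < 1 / (Real.pi * v) := by positivity
  have hm0 := abs_nonneg (m : ℝ)
  set t := (z 0).im * (z 1).im with ht
  have ht0 : 0 < t := by positivity
  have ht1 : 1 ≤ t ∧ v ≤ t := by
    have h1 : 1 ≤ (z 1).im := by linarith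
    have h2 : (z 1).im ≤ t := by
      rw [ht, hz]; nlinarith [mul_le_mul hA h1 zero_le_one (by linarith)]
    constructor <;> linarith
  have key : ENNReal.ofReal (Xi v m z) ≤ ENNReal.ofReal
      (cuspConst v m * Real.exp (-(Real.pi * v * (A / 4))) * √t + B.toReal) := by
    refine (ofReal_Xi_le hv m z).trans ?_
    rw [ENNReal.ofReal_add (by rw [cuspConst]; positivity) ENNReal.toReal_nonneg,
      ENNReal.ofReal_toReal hBtop]
    refine add_le_add ((tsum_of_eq_zero_le hv hm hA hAm hAv hz).trans ?_)
      (tsum_of_ne_zero_le hv hA hz (by linarith))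
    -- The only unbounded factor; `t ≥ v` ensures that the parameter is at most `π`, as
    -- `thetaSum_le` needs.
    have hθ : thetaSum (Real.pi * v / t / 2) ≤
        ENNReal.ofReal (√(2 / v) * √t) * thetaSum Real.pi := by
      refine (thetaSum_le (by positivity) ?_).trans_eq ?_
      · rw [div_div, div_le_iff₀ (by positivity)]
        nlinarith [mul_le_mul_of_nonneg_left ht1.2 hπ.le, mul_pos hπ ht0]
      · rw [← Real.sqrt_mul (by positivity)]
        congr 3
        field_simp
    have he : Real.exp (Real.pi * v / t) ≤ Real.exp (Real.pi * v) :=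
      Real.exp_le_exp.mpr (div_le_self hpv.le ht1.1)
    calc _ ≤ ((antidiagonalBox m).card : ℝ≥0∞) *
          (ENNReal.ofReal (Real.exp (-(Real.pi * v * (A / 4)))) *
          (ENNReal.ofReal (Real.exp (Real.pi * v)) *
            (ENNReal.ofReal (√(2 / v) * √t) * thetaSum Real.pi))) := by gcongr
      _ = _ := by
        rw [← ENNReal.ofReal_natCast, ← ENNReal.ofReal_toReal hΘ,
          ← ENNReal.ofReal_mul (by positivity), ← ENNReal.ofReal_mul (by positivity),
          ← ENNReal.ofReal_mul (by positivity), ← ENNReal.ofReal_mul (by positivity),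
          cuspConst]
        congr 1
        ring
  exact (ENNReal.ofReal_le_ofReal_iff (by rw [cuspConst]; positivity)).mp key

lemma R_pos_of_neg {m : ℤ} (hm : m < 0) (z : Fin 2 → UpperHalfPlane) (M : L m) :
    0 < R z M.1 := by
  have h := two_mul_R_add z M.1
  have hy0 := (z 0).im_pos
  have hy1 := (z 1).im_pos
  rw [M.2] at h
  have hm' : (m : ℝ) < 0 := by exact_mod_cast hm
  have : 0 ≤ 2 * R z M.1 + 2 * (m : ℝ) := by rw [h]; positivity
  linarith

lemma not_mem_heckeSet_of_neg {m : ℤ} (hm : m < 0) (z : Fin 2 → UpperHalfPlane) :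
    z ∉ heckeSet m := by
  rw [mem_heckeSet_iff]
  rintro ⟨M, hM⟩
  exact (R_pos_of_neg hm z M).ne' hM

/-- The matrices `(a 1; -m 0)`. -/
def translationMatrix (m a : ℤ) : L m := ⟨!![a, 1; -m, 0], by simp [Matrix.det_fin_two_of]⟩

lemma R_translationMatrix (m a : ℤ) {z : Fin 2 → UpperHalfPlane} (hz : (z 0).im = (z 1).im) :
    R z (translationMatrix m a).1 =
      ((a : ℝ) - ((z 1).re - m * (z 0).re)) ^ 2 / (2 * (z 1).im ^ 2) + (m - 1 : ℝ) ^ 2 / 2 := by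
  have h := two_mul_R_add z (translationMatrix m a).1
  rw [(translationMatrix m a).2, hz] at h
  simp only [translationMatrix, Matrix.of_apply, Matrix.cons_val', Matrix.cons_val_zero,
    Matrix.cons_val_one, Matrix.cons_val_fin_one, Int.cast_neg, Int.cast_one, Int.cast_zero] at h ⊢
  have hy1 := (z 1).im_ne_zero
  field_simp at h ⊢
  linear_combination h

/-- On the diagonal ray, each matrix `(a 1; -m 0)` with `|a - s| ≤ y` has `2R ≤ 1 + (m - 1)²`, so it
contributes at least a fixed positive amount. -/
lemma le_Xi_of_neg {v : ℝ} (hv : 0 < v) {m : ℤ} (hm : m < 0) {z : Fin 2 → UpperHalfPlane}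
    (hz : (z 0).im = (z 1).im) (hy : 1 ≤ (z 1).im) :
    1 / 2 * negEiNeg (Real.pi * v * (1 + (m - 1 : ℝ) ^ 2)) * (z 1).im ≤ Xi v m z := by
  have hπ := Real.pi_pos
  have hs := summable_negEiNeg hv m z
  have hinj : Function.Injective (translationMatrix m) := fun a b h => by
    have := congrArg (fun M : L m => M.1 0 0) h
    simpa [translationMatrix] using this
  set s := (z 1).re - m * (z 0).re
  set y := (z 1).im with hy'
  set I := Finset.Icc ⌈s - y⌉ ⌊s + y⌋
  -- An interval of length `2y` contains more than `2y - 1 ≥ y` integers.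
  have hcard : y ≤ I.card := by
    have h1 := Int.ceil_lt_add_one (s - y)
    have h2 := Int.lt_floor_add_one (s + y)
    have h3 : ((⌊s + y⌋ + 1 - ⌈s - y⌉ : ℤ) : ℝ) ≤ I.card := by
      rw [Int.card_Icc]
      exact_mod_cast Int.self_le_toNat _
    push_cast at h3
    linarith
  have hterm : ∀ a ∈ I, negEiNeg (Real.pi * v * (1 + (m - 1 : ℝ) ^ 2)) ≤
      negEiNeg (2 * Real.pi * v * R z (translationMatrix m a).1) := by
    intro a ha
    obtain ⟨h1, h2⟩ := Finset.mem_Icc.mp ha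
    have h1' := Int.ceil_le.mp h1
    have h2' := Int.le_floor.mp h2
    refine negEiNeg_anti (mul_pos (by positivity) (R_pos_of_neg hm z _)) ?_
    rw [R_translationMatrix m a hz, ← hy']
    have h3 : ((a : ℝ) - s) ^ 2 ≤ y ^ 2 := sq_le_sq' (by linarith) (by linarith)
    have h4 : ((a : ℝ) - s) ^ 2 / (2 * y ^ 2) ≤ 1 / 2 := by
      rw [div_le_iff₀ (by positivity)]
      linarith
    have : 0 < Real.pi * v := by positivity
    nlinarith
  have h1 := Finset.card_nsmul_le_sum I _ _ hterm
  rw [nsmul_eq_mul] at h1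
  have h2 : ∑ a ∈ I, negEiNeg (2 * Real.pi * v * R z (translationMatrix m a).1) ≤
      ∑' M : L m, negEiNeg (2 * Real.pi * v * R z M.1) := by
    exact (Finset.sum_map I ⟨_, hinj⟩ fun M : L m => negEiNeg (2 * Real.pi * v * R z M.1)).ge.trans
      (hs.sum_le_tsum _ fun _ _ => negEiNeg_nonneg _)
  have h3 := mul_le_mul_of_nonneg_right hcard
    (negEiNeg_nonneg (Real.pi * v * (1 + (m - 1 : ℝ) ^ 2)))
  rw [Xi]
  linarith

/-! ## Invariance under `SL₂(ℤ) × SL₂(ℤ)` -/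

open Matrix in
/-- The bijection `M ↦ g₀⁻¹ M g₁⁻ᵀ` of `L m`. -/
def conjL (m : ℤ) (g : Fin 2 → SpecialLinearGroup (Fin 2) ℤ) : L m ≃ L m where
  toFun M := ⟨adjugate (g 0).1 * M.1 * (adjugate (g 1).1)ᵀ, by
    rw [det_mul, det_mul, det_transpose, det_adjugate, det_adjugate, (g 0).2, (g 1).2, M.2,
      one_pow, one_mul, mul_one]⟩
  invFun M := ⟨(g 0).1 * M.1 * ((g 1).1)ᵀ, by
    rw [det_mul, det_mul, det_transpose, (g 0).2, (g 1).2, M.2, one_mul, mul_one]⟩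
  left_inv M := by
    have h0 : (g 0).1 * adjugate (g 0).1 = 1 := by rw [mul_adjugate, (g 0).2, one_smul]
    have h1 : (g 1).1 * adjugate (g 1).1 = 1 := by rw [mul_adjugate, (g 1).2, one_smul]
    apply Subtype.ext
    change (g 0).1 * (adjugate (g 0).1 * M.1 * (adjugate (g 1).1)ᵀ) * ((g 1).1)ᵀ = M.1
    rw [Matrix.mul_assoc, Matrix.mul_assoc _ _ ((g 1).1)ᵀ, ← transpose_mul, h1, transpose_one,
      Matrix.mul_one, ← Matrix.mul_assoc, h0, Matrix.one_mul]
  right_inv M := by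
    have h0 : adjugate (g 0).1 * (g 0).1 = 1 := by rw [adjugate_mul, (g 0).2, one_smul]
    have h1 : adjugate (g 1).1 * (g 1).1 = 1 := by rw [adjugate_mul, (g 1).2, one_smul]
    apply Subtype.ext
    change adjugate (g 0).1 * ((g 0).1 * M.1 * ((g 1).1)ᵀ) * (adjugate (g 1).1)ᵀ = M.1
    rw [Matrix.mul_assoc, Matrix.mul_assoc _ _ (adjugate (g 1).1)ᵀ, ← transpose_mul, h1,
      transpose_one, Matrix.mul_one, ← Matrix.mul_assoc, h0, Matrix.one_mul]

/-- With `j_i = c z_i + d` the automorphy factor of `g i`, the bilinear form in `R` acquires `1/(j₀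
j₁)` and each imaginary part `1/|j_i|²`; these cancel. -/
lemma R_smul {m : ℤ} (g : Fin 2 → Matrix.SpecialLinearGroup (Fin 2) ℤ)
    (z : Fin 2 → UpperHalfPlane) (M : L m) :
    R (fun i => g i • z i) M.1 = R z (conjL m g M).1 := by
  have hj : ∀ i, ((g i 1 0 : ℂ) * (z i : ℂ) + (g i 1 1 : ℂ)) ≠ 0 := fun i => by
    have := UpperHalfPlane.denom_ne_zero (g i) (z i)
    rwa [ModularGroup.denom_apply] at this
  have hc : ∀ i, ((g i • z i : UpperHalfPlane) : ℂ) =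
      ((g i 0 0 : ℂ) * (z i : ℂ) + (g i 0 1 : ℂ)) / ((g i 1 0 : ℂ) * (z i : ℂ) + (g i 1 1 : ℂ)) :=
    fun i => by simpa using UpperHalfPlane.coe_specialLinearGroup_apply (g i) (z i)
  have him : ∀ i, (g i • z i : UpperHalfPlane).im =
      (z i).im / ‖((g i 1 0 : ℂ) * (z i : ℂ) + (g i 1 1 : ℂ))‖ ^ 2 := fun i => by
    rw [ModularGroup.im_smul_eq_div_normSq, ModularGroup.denom_apply,
      Complex.sq_norm]
  have hform : ((M.1 0 0 : ℂ) - (M.1 0 1 : ℂ) * ((g 1 • z 1 : UpperHalfPlane) : ℂ)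
      - (M.1 1 0 : ℂ) * ((g 0 • z 0 : UpperHalfPlane) : ℂ)
      + (M.1 1 1 : ℂ) * ((g 0 • z 0 : UpperHalfPlane) : ℂ) * ((g 1 • z 1 : UpperHalfPlane) : ℂ)) =
      (((conjL m g M).1 0 0 : ℂ) - ((conjL m g M).1 0 1 : ℂ) * (z 1 : ℂ)
        - ((conjL m g M).1 1 0 : ℂ) * (z 0 : ℂ)
        + ((conjL m g M).1 1 1 : ℂ) * (z 0 : ℂ) * (z 1 : ℂ)) /
      (((g 0 1 0 : ℂ) * (z 0 : ℂ) + (g 0 1 1 : ℂ)) *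
        ((g 1 1 0 : ℂ) * (z 1 : ℂ) + (g 1 1 1 : ℂ))) := by
    have h0 := hj 0
    have h1 := hj 1
    rw [hc, hc]
    simp only [conjL, Equiv.coe_fn_mk, Matrix.adjugate_fin_two, Matrix.mul_apply,
      Fin.sum_univ_two, Matrix.transpose_apply, Matrix.of_apply, Matrix.cons_val',
      Matrix.cons_val_zero, Matrix.cons_val_one, Matrix.cons_val_fin_one]
    push_cast
    rw [eq_div_iff (mul_ne_zero h0 h1)]
    have e0 := div_mul_cancel₀ ((g 0 0 0 : ℂ) * (z 0 : ℂ) + (g 0 0 1 : ℂ)) h0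
    have e1 := div_mul_cancel₀ ((g 1 0 0 : ℂ) * (z 1 : ℂ) + (g 1 0 1 : ℂ)) h1
    generalize ((g 0 0 0 : ℂ) * (z 0 : ℂ) + (g 0 0 1 : ℂ)) /
      ((g 0 1 0 : ℂ) * (z 0 : ℂ) + (g 0 1 1 : ℂ)) = w0 at e0 ⊢
    generalize ((g 1 0 0 : ℂ) * (z 1 : ℂ) + (g 1 0 1 : ℂ)) /
      ((g 1 1 0 : ℂ) * (z 1 : ℂ) + (g 1 1 1 : ℂ)) = w1 at e1 ⊢
    linear_combination
      (M.1 1 1 * w1 * ((g 1 1 0 : ℂ) * (z 1 : ℂ) + (g 1 1 1 : ℂ))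
        - M.1 1 0 * ((g 1 1 0 : ℂ) * (z 1 : ℂ) + (g 1 1 1 : ℂ))) * e0
      + (M.1 1 1 * ((g 0 0 0 : ℂ) * (z 0 : ℂ) + (g 0 0 1 : ℂ))
        - M.1 0 1 * ((g 0 1 0 : ℂ) * (z 0 : ℂ) + (g 0 1 1 : ℂ))) * e1
  rw [R, R, hform, him, him, norm_div, norm_mul]
  have h0 := norm_ne_zero_iff.mpr (hj 0)
  have h1 := norm_ne_zero_iff.mpr (hj 1)
  have := (z 0).im_ne_zero
  have := (z 1).im_ne_zero
  generalize ‖((g 0 1 0 : ℂ) * (z 0 : ℂ) + (g 0 1 1 : ℂ))‖ = j0 at *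
  generalize ‖((g 1 1 0 : ℂ) * (z 1 : ℂ) + (g 1 1 1 : ℂ))‖ = j1 at *
  field_simp

lemma Xi_smul (v : ℝ) (m : ℤ) (g : Fin 2 → Matrix.SpecialLinearGroup (Fin 2) ℤ)
    (z : Fin 2 → UpperHalfPlane) : Xi v m (fun i => g i • z i) = Xi v m z := by
  rw [Xi, Xi, ← (conjL m g).tsum_eq fun M => negEiNeg (2 * Real.pi * v * R z M.1)]
  simp only [R_smul]

lemma smul_mem_heckeSet {m : ℤ} (g : Fin 2 → Matrix.SpecialLinearGroup (Fin 2) ℤ)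
    {z : Fin 2 → UpperHalfPlane} : (fun i => g i • z i) ∈ heckeSet m ↔ z ∈ heckeSet m := by
  simp only [mem_heckeSet_iff, R_smul]
  exact ((conjL m g).surjective.exists (p := fun M => R z M.1 = 0)).symm

lemma exists_smul_of_proj_eq {z w : Fin 2 → UpperHalfPlane} (h : proj z = proj w) :
    ∃ g : Fin 2 → Matrix.SpecialLinearGroup (Fin 2) ℤ, z = fun i => g i • w i := by
  have h1 : ∀ i, ∃ g : Matrix.SpecialLinearGroup (Fin 2) ℤ, g • w i = z i := fun i => by
    have := OnePoint.coe_injective (congrFun h i)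
    exact Quotient.exact this
  choose g hg using h1
  exact ⟨g, funext fun i => (hg i).symm⟩

open Classical in
lemma exists_descent (v : ℝ) (m : ℤ) : ∃ g : X → ℝ, IsDescentOfXi v m g := by
  refine ⟨fun x => if h : ∃ z, proj z = x then Xi v m h.choose else 0, fun z _ => ?_⟩
  have h : ∃ w, proj w = proj z := ⟨z, rfl⟩
  dsimp only
  rw [dif_pos h]
  obtain ⟨g, hg⟩ := exists_smul_of_proj_eq h.choose_spec
  rw [hg, Xi_smul]

/-! ## The cuspidal chart -/

lemma cuspChart_qParam (z : UpperHalfPlane) :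
    cuspChart (Function.Periodic.qParam 1 (z : ℂ)) = proj1 z := by
  obtain ⟨n, hn⟩ := Function.Periodic.qParam_left_inv_mod_period (h := 1) one_ne_zero (z : ℂ)
  rw [cuspChart, if_neg (Function.Periodic.qParam_ne_zero _), hn]
  -- `invQParam` recovers `z` up to an integer translation, which lies in `SL₂(ℤ)`.
  have : (z : ℂ) + n * ((1 : ℝ) : ℂ) = ((ModularGroup.T ^ n • z : UpperHalfPlane) : ℂ) := by
    rw [UpperHalfPlane.modular_T_zpow_smul]
    simp [add_comm]
  rw [this, UpperHalfPlane.ofComplex_apply, proj1, proj1]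
  congr 1
  exact Quotient.sound ⟨ModularGroup.T ^ n, rfl⟩

lemma chart_qCoord (z : Fin 2 → UpperHalfPlane) : chart Finset.univ (qCoord z) = proj z := by
  funext i
  simp [chart, qCoord, proj, cuspChart_qParam]

lemma norm_qCoord (z : Fin 2 → UpperHalfPlane) (i : Fin 2) :
    ‖qCoord z i‖ = Real.exp (-(2 * Real.pi * (z i).im)) := by
  rw [qCoord, Function.Periodic.norm_qParam]
  congr 1
  simp

lemma qCoord_ne_zero (z : Fin 2 → UpperHalfPlane) (i : Fin 2) : qCoord z i ≠ 0 :=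
  Function.Periodic.qParam_ne_zero _

lemma exists_qCoord_eq {w : Fin 2 → ℂ} (h0 : ∀ i, w i ≠ 0) (h1 : ∀ i, ‖w i‖ < 1) :
    ∃ z, qCoord z = w := by
  have him : ∀ i, 0 < (Function.Periodic.invQParam 1 (w i)).im := fun i => by
    rw [Function.Periodic.im_invQParam]
    have := Real.log_neg (norm_pos_iff.mpr (h0 i)) (h1 i)
    have := Real.pi_pos
    rw [neg_div, neg_mul, Left.neg_pos_iff]
    exact mul_neg_of_pos_of_neg (by positivity) ‹_›
  refine ⟨fun i => ⟨_, him i⟩, funext fun i => ?_⟩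
  exact Function.Periodic.qParam_right_inv one_ne_zero (h0 i)

lemma mem_chartHecke_iff {m : ℤ} {w : Fin 2 → ℂ} :
    w ∈ chartHecke m Finset.univ ↔ ∃ z ∈ heckeSet m, qCoord z = w := by
  constructor
  · rintro ⟨hw, z, hz, hzw⟩
    have h0 : ∀ i, w i ≠ 0 := fun i hi => by
      have := congrFun hzw i
      simp [chart, cuspChart, hi, proj, proj1] at this
    obtain ⟨z', rfl⟩ := exists_qCoord_eq h0 fun i => by simpa using hw i
    rw [chart_qCoord] at hzw
    obtain ⟨g, rfl⟩ := exists_smul_of_proj_eq hzw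
    exact ⟨z', (smul_mem_heckeSet g).mp hz, rfl⟩
  · rintro ⟨z, hz, rfl⟩
    refine ⟨fun i => ?_, z, hz, (chart_qCoord z).symm⟩
    rw [if_pos (Finset.mem_univ i)]
    exact Function.Periodic.norm_qParam_lt_one (by norm_num) (z i).im_pos

/-! ## The local equation of `T(m)` at `(∞, ∞)` -/

/-- A polydisc around `(∞, ∞)`. -/
def heckeNhd (m : ℤ) : Set (Fin 2 → ℂ) :=
  {w | ∀ i, ‖w i‖ < Real.exp (-(2 * Real.pi * (|(m : ℝ)| + 1)))}

/-- The local equation `∏ (q₁ ^ d - q₂ ^ a)` of `T(m)`, over `a d = m` with `a, d > 0`. -/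
def heckeEq (m : ℤ) (w : Fin 2 → ℂ) : ℂ :=
  ∏ p ∈ m.toNat.divisorsAntidiagonal, (w 0 ^ p.1 - w 1 ^ p.2)

lemma qCoord_mem_heckeNhd {m : ℤ} {z : Fin 2 → UpperHalfPlane} :
    qCoord z ∈ heckeNhd m ↔ ∀ i, |(m : ℝ)| + 1 < (z i).im := by
  refine forall_congr' fun i => ?_
  rw [norm_qCoord, Real.exp_lt_exp, neg_lt_neg_iff]
  exact mul_lt_mul_iff_right₀ (by positivity)

lemma qCoord_pow (z : Fin 2 → UpperHalfPlane) (i : Fin 2) (n : ℕ) :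
    qCoord z i ^ n = Complex.exp (2 * Real.pi * Complex.I * (n * (z i : ℂ))) := by
  rw [qCoord, Function.Periodic.qParam, ← Complex.exp_nat_mul]
  congr 1
  push_cast
  ring

lemma mem_divisorsAntidiagonal_toNat {m : ℤ} {p : ℕ × ℕ}
    (hp : p ∈ m.toNat.divisorsAntidiagonal) : 0 < p.1 ∧ 0 < p.2 ∧ (p.1 : ℤ) * p.2 = m := by
  obtain ⟨h1, h2⟩ := Nat.mem_divisorsAntidiagonal.mp hp
  have hpos : 0 < p.1 * p.2 := by omega
  refine ⟨Nat.pos_of_mul_pos_right hpos, Nat.pos_of_mul_pos_left hpos, ?_⟩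
  have : ((p.1 * p.2 : ℕ) : ℤ) = m := by omega
  exact_mod_cast this

lemma exists_pow_eq_of_mem_heckeSet {m : ℤ} (hm : m ≠ 0) {z : Fin 2 → UpperHalfPlane}
    (hz : ∀ i, |(m : ℝ)| + 1 < (z i).im) (h : z ∈ heckeSet m) :
    ∃ p ∈ m.toNat.divisorsAntidiagonal, qCoord z 0 ^ p.1 = qCoord z 1 ^ p.2 := by
  have hcc := h
  rw [mem_heckeSet_iff] at hcc
  obtain ⟨M, hM⟩ := hcc
  have hd : M.1 1 1 = 0 := by
    by_contra hd
    -- `R = 0` would give `y₁y₂ ≤ 2m`, but `y₁y₂ > (|m| + 1)² > 2m`; this fixes the radius of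
    -- `heckeNhd`.
    have h1 := R_ge_of_ne_zero z M hd
    rw [hM] at h1
    have := abs_nonneg (m : ℝ)
    have := le_abs_self (m : ℝ)
    nlinarith [mul_lt_mul'' (hz 0) (hz 1) (by linarith) (by linarith)]
  have hbc := mul_eq_of_eq_zero M hd
  rw [R_eq_zero_iff, hd] at hM
  simp only [Int.cast_zero, zero_mul, add_zero] at hM
  -- `a - b z₂ - c z₁ = 0` with `b c = -m`
  have him := congrArg Complex.im hM
  simp only [Complex.sub_im, Complex.mul_im, Complex.intCast_re, Complex.intCast_im,
    UpperHalfPlane.coe_re, UpperHalfPlane.coe_im, Complex.zero_im, zero_mul, add_zero] at him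
  have hy0 := (z 0).im_pos
  have hy1 := (z 1).im_pos
  generalize M.1 0 1 = b at *
  generalize M.1 1 0 = c at *
  generalize M.1 0 0 = a at *
  -- The imaginary part reads `b y₂ + c y₁ = 0`, so `b` and `c` have opposite signs. In particular
  -- `m > 0`.
  have hneg : b * c < 0 := by
    by_contra hcon
    have h1 : 0 < b * c := lt_of_le_of_ne (not_lt.mp hcon) (by rw [hbc]; simpa [eq_comm] using hm)
    rcases mul_pos_iff.mp h1 with ⟨hb, hc⟩ | ⟨hb, hc⟩
    · have hb' : (0 : ℝ) < b := by exact_mod_cast hb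
      have hc' : (0 : ℝ) < c := by exact_mod_cast hc
      nlinarith [mul_pos hb' hy1, mul_pos hc' hy0]
    · have hb' : (b : ℝ) < 0 := by exact_mod_cast hb
      have hc' : (c : ℝ) < 0 := by exact_mod_cast hc
      nlinarith [mul_pos_of_neg_of_neg hb' (neg_neg_of_pos hy1),
        mul_pos_of_neg_of_neg hc' (neg_neg_of_pos hy0)]
  refine ⟨(c.natAbs, b.natAbs), ?_, ?_⟩
  · rw [Nat.mem_divisorsAntidiagonal]
    constructor
    · zify
      rw [← abs_mul, mul_comm c b, abs_of_neg hneg]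
      omega
    · omega
  · rw [qCoord_pow, qCoord_pow, Complex.exp_eq_exp_iff_exists_int]
    dsimp only
    rcases mul_neg_iff.mp hneg with ⟨hb, hc⟩ | ⟨hb, hc⟩
    · refine ⟨-a, ?_⟩
      have h1 : ((c.natAbs : ℕ) : ℂ) = -c := by
        rw [← Int.cast_natCast, Int.natCast_natAbs, abs_of_neg hc]; simp
      have h2 : ((b.natAbs : ℕ) : ℂ) = b := by
        rw [← Int.cast_natCast, Int.natCast_natAbs, abs_of_pos hb]
      rw [h1, h2]
      push_cast
      linear_combination 2 * Real.pi * Complex.I * hM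
    · refine ⟨a, ?_⟩
      have h1 : ((c.natAbs : ℕ) : ℂ) = c := by
        rw [← Int.cast_natCast, Int.natCast_natAbs, abs_of_pos hc]
      have h2 : ((b.natAbs : ℕ) : ℂ) = -b := by
        rw [← Int.cast_natCast, Int.natCast_natAbs, abs_of_neg hb]; simp
      rw [h1, h2]
      linear_combination -2 * Real.pi * Complex.I * hM

lemma mem_heckeSet_of_pow_eq {m : ℤ} {z : Fin 2 → UpperHalfPlane} {p : ℕ × ℕ}
    (hp : p ∈ m.toNat.divisorsAntidiagonal) (h : qCoord z 0 ^ p.1 = qCoord z 1 ^ p.2) :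
    z ∈ heckeSet m := by
  obtain ⟨-, -, hpm⟩ := mem_divisorsAntidiagonal_toNat hp
  rw [qCoord_pow, qCoord_pow, Complex.exp_eq_exp_iff_exists_int] at h
  obtain ⟨n, hn⟩ := h
  refine ⟨⟨!![(p.2 : ℤ), n; 0, (p.1 : ℤ)], by rw [Matrix.det_fin_two_of]; linarith⟩, ?_⟩
  simp only [Matrix.of_apply, Matrix.cons_val', Matrix.cons_val_zero, Matrix.cons_val_one,
    Matrix.cons_val_fin_one, Int.cast_zero, Int.cast_natCast]
  have := Complex.two_pi_I_ne_zero
  refine mul_left_cancel₀ this ?_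
  linear_combination hn

lemma mem_heckeSet_iff_heckeEq {m : ℤ} (hm : m ≠ 0) {z : Fin 2 → UpperHalfPlane}
    (hz : ∀ i, |(m : ℝ)| + 1 < (z i).im) : z ∈ heckeSet m ↔ heckeEq m (qCoord z) = 0 := by
  rw [heckeEq, Finset.prod_eq_zero_iff]
  simp only [sub_eq_zero]
  exact ⟨exists_pow_eq_of_mem_heckeSet hm hz, fun ⟨p, hp, h⟩ => mem_heckeSet_of_pow_eq hp h⟩

lemma isOpen_heckeNhd (m : ℤ) : IsOpen (heckeNhd m) := by
  rw [heckeNhd, Set.ofPred_forall]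
  exact isOpen_iInter_of_finite fun i => isOpen_lt (by fun_prop) continuous_const

lemma zero_mem_heckeNhd (m : ℤ) : (0 : Fin 2 → ℂ) ∈ heckeNhd m := fun i => by
  simpa using Real.exp_pos _

lemma norm_lt_one_of_mem_heckeNhd {m : ℤ} {w : Fin 2 → ℂ} (hw : w ∈ heckeNhd m) (i : Fin 2) :
    ‖w i‖ < 1 :=
  (hw i).trans_le (Real.exp_le_one_iff.mpr (neg_nonpos.mpr (by positivity)))

lemma heckeNhd_subset (m : ℤ) : heckeNhd m ⊆ chartDomain Finset.univ := fun w hw i => by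
  rw [if_pos (Finset.mem_univ i)]
  exact norm_lt_one_of_mem_heckeNhd hw i

lemma differentiable_prod_branches (s : Finset (ℕ × ℕ)) :
    Differentiable ℂ fun w : Fin 2 → ℂ => ∏ p ∈ s, (w 0 ^ p.1 - w 1 ^ p.2) := by
  classical
  induction s using Finset.induction_on with
  | empty => simp
  | insert p s hp ih =>
    simp only [Finset.prod_insert hp]
    fun_prop

lemma differentiable_heckeEq (m : ℤ) : Differentiable ℂ (heckeEq m) :=
  differentiable_prod_branches _

lemma mem_chartHecke_iff_of_mem_heckeNhd {m : ℤ} (hm : m ≠ 0) {w : Fin 2 → ℂ}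
    (hw : w ∈ heckeNhd m) :
    w ∈ chartHecke m Finset.univ ↔ (∀ i, w i ≠ 0) ∧ heckeEq m w = 0 := by
  rw [mem_chartHecke_iff]
  constructor
  · rintro ⟨z, hz, rfl⟩
    exact ⟨qCoord_ne_zero z, (mem_heckeSet_iff_heckeEq hm (qCoord_mem_heckeNhd.mp hw)).mp hz⟩
  · rintro ⟨h0, hf⟩
    obtain ⟨z, rfl⟩ := exists_qCoord_eq h0 (norm_lt_one_of_mem_heckeNhd hw)
    exact ⟨z, (mem_heckeSet_iff_heckeEq hm (qCoord_mem_heckeNhd.mp hw)).mpr hf, rfl⟩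

lemma mem_closure_inter {m : ℤ} {w : Fin 2 → ℂ} (hw : w ∈ heckeNhd m)
    (h : w ∈ closure (chartHecke m Finset.univ)) :
    w ∈ closure (heckeNhd m ∩ chartHecke m Finset.univ) :=
  (isOpen_heckeNhd m).inter_closure ⟨hw, h⟩

lemma exists_factor_eq_zero {m : ℤ} {w : Fin 2 → ℂ} (h : heckeEq m w = 0) :
    ∃ p ∈ m.toNat.divisorsAntidiagonal, w 0 ^ p.1 = w 1 ^ p.2 := by
  simpa only [heckeEq, Finset.prod_eq_zero_iff, sub_eq_zero] using h

/-- Two different branches of `T(m)` meet only on the boundary. -/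
lemma factor_unique {m : ℤ} {w : Fin 2 → ℂ} (h1 : w 1 ≠ 0) (hw : ∀ i, ‖w i‖ < 1)
    {p p' : ℕ × ℕ} (hp : p ∈ m.toNat.divisorsAntidiagonal)
    (hp' : p' ∈ m.toNat.divisorsAntidiagonal) (h : w 0 ^ p.1 = w 1 ^ p.2)
    (h' : w 0 ^ p'.1 = w 1 ^ p'.2) : p = p' := by
  obtain ⟨hd, ha, hpm⟩ := mem_divisorsAntidiagonal_toNat hp
  obtain ⟨hd', ha', hpm'⟩ := mem_divisorsAntidiagonal_toNat hp'
  -- Absolute values give `|q₁| = |q₂|^(a/d)` on each branch, so the slopes `a/d` agree; since the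
  -- products `ad` agree too, the pairs coincide.
  have e : ‖w 1‖ ^ (p.2 * p'.1) = ‖w 1‖ ^ (p'.2 * p.1) := by
    rw [pow_mul, pow_mul, ← norm_pow, ← norm_pow (w 1) p'.2, ← h, ← h', norm_pow, norm_pow,
      ← pow_mul, ← pow_mul, mul_comm]
  have e1 : p.2 * p'.1 = p'.2 * p.1 :=
    pow_right_injective₀ (norm_pos_iff.mpr h1) (hw 1).ne e
  have e2 : p.1 * p.2 = p'.1 * p'.2 := by zify; rw [hpm, hpm']
  have e3 : p.1 = p'.1 := by
    have : p.1 ^ 2 = p'.1 ^ 2 := by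
      refine Nat.eq_of_mul_eq_mul_right ha' ?_
      calc p.1 ^ 2 * p'.2 = p.1 * (p'.2 * p.1) := by ring
        _ = (p.1 * p.2) * p'.1 := by rw [← e1]; ring
        _ = p'.1 ^ 2 * p'.2 := by rw [e2]; ring
    exact Nat.pow_left_injective two_ne_zero this
  refine Prod.ext e3 ?_
  rw [e3] at e2
  exact Nat.eq_of_mul_eq_mul_left hd' e2

lemma fderiv_heckeEq_ne_zero {m : ℤ} {w : Fin 2 → ℂ} (h0 : ∀ i, w i ≠ 0) (hw : ∀ i, ‖w i‖ < 1)
    (h : heckeEq m w = 0) : fderiv ℂ (heckeEq m) w ≠ 0 := by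
  classical
  obtain ⟨p, hp, hpw⟩ := exists_factor_eq_zero h
  obtain ⟨hd, -, -⟩ := mem_divisorsAntidiagonal_toNat hp
  let G : (Fin 2 → ℂ) → ℂ := fun w =>
    ∏ p' ∈ m.toNat.divisorsAntidiagonal.erase p, (w 0 ^ p'.1 - w 1 ^ p'.2)
  have hG : G w ≠ 0 := Finset.prod_ne_zero_iff.mpr fun p' hp' h' => by
    obtain ⟨hne, hp'⟩ := Finset.mem_erase.mp hp'
    exact hne (factor_unique (h0 1) hw hp' hp (sub_eq_zero.mp h') hpw)
  have hGd : DifferentiableAt ℂ G w := differentiable_prod_branches _ w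
  have heq : heckeEq m = fun w => (w 0 ^ p.1 - w 1 ^ p.2) * G w :=
    funext fun w => (Finset.mul_prod_erase _ _ hp).symm
  have hpd : HasFDerivAt (fun w : Fin 2 → ℂ => w 0 ^ p.1 - w 1 ^ p.2) _ w :=
    ((hasFDerivAt_apply (𝕜 := ℂ) (0 : Fin 2) w).pow p.1).sub
      ((hasFDerivAt_apply (𝕜 := ℂ) (1 : Fin 2) w).pow p.2)
  have hd' : HasFDerivAt (heckeEq m) _ w :=
    (hpd.mul hGd.hasFDerivAt).congr_of_eventuallyEq (.of_eq heq)
  rw [hd'.fderiv]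
  intro hzero
  -- Only the factor of `p` vanishes, so the derivative in `q₁` is `d q₁^(d-1) G(w) ≠ 0`.
  have hz := DFunLike.congr_fun hzero (Pi.single 0 1)
  simp [hpw, hG, h0 0, hd.ne'] at hz

lemma zero_mem_closure {m : ℤ} (hm : 0 < m) :
    (0 : Fin 2 → ℂ) ∈ closure (chartHecke m Finset.univ) := by
  have hm0 : m.toNat ≠ 0 := by omega
  -- The branch `q₁ = q₂^m`, followed to the origin.
  let u : ℝ → Fin 2 → ℂ := fun t => ![(t : ℂ) ^ m.toNat, (t : ℂ)]
  have hu : Continuous u := by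
    refine continuous_pi fun i => ?_
    fin_cases i
    · exact Complex.continuous_ofReal.pow _
    · exact Complex.continuous_ofReal
  have hu0 : u 0 = 0 := by
    funext i
    fin_cases i <;> simp [u, hm0]
  have ht : Tendsto u (𝓝[>] 0) (𝓝 0) := by
    have := hu.tendsto 0
    rw [hu0] at this
    exact this.mono_left nhdsWithin_le_nhds
  refine mem_closure_of_tendsto ht ?_
  filter_upwards [ht.eventually ((isOpen_heckeNhd m).mem_nhds (zero_mem_heckeNhd m)),
    self_mem_nhdsWithin] with t htW ht0
  have ht0' : (t : ℂ) ≠ 0 := Complex.ofReal_ne_zero.mpr (ne_of_gt ht0)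
  refine (mem_chartHecke_iff_of_mem_heckeNhd hm.ne' htW).mpr ⟨fun i => ?_, ?_⟩
  · fin_cases i
    · exact pow_ne_zero _ ht0'
    · exact ht0'
  · refine Finset.prod_eq_zero (i := (1, m.toNat)) ?_ ?_
    · simp [hm0]
    · simp [u]

theorem isLocalEquation_heckeEq {m : ℤ} (hm : m ≠ 0) :
    IsLocalEquation m Finset.univ (heckeNhd m) (heckeEq m) where
  isOpen := isOpen_heckeNhd m
  subset := heckeNhd_subset m
  holomorphic := (differentiable_heckeEq m).differentiableOn
  zeros w hw := by
    constructor
    · intro h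
      obtain ⟨p, hp, hpw⟩ := exists_factor_eq_zero h
      obtain ⟨hd, ha, hpm⟩ := mem_divisorsAntidiagonal_toNat hp
      by_cases h0 : ∀ i, w i ≠ 0
      · exact subset_closure ((mem_chartHecke_iff_of_mem_heckeNhd hm hw).mpr ⟨h0, h⟩)
      · have h00 : w 0 = 0 ↔ w 1 = 0 := by
          rw [← pow_eq_zero_iff hd.ne', hpw, pow_eq_zero_iff ha.ne']
        have hw0 : w = 0 := by
          simp only [Fin.forall_fin_two] at h0
          funext i
          fin_cases i
          · simp only [Fin.zero_eta, Pi.zero_apply]; tauto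
          · simp only [Fin.mk_one, Pi.zero_apply]; tauto
        rw [hw0]
        refine zero_mem_closure ?_
        rw [← hpm]
        positivity
    · intro h
      have hsub : heckeNhd m ∩ chartHecke m Finset.univ ⊆ {w | heckeEq m w = 0} :=
        fun w hw => ((mem_chartHecke_iff_of_mem_heckeNhd hm hw.1).mp hw.2).2
      exact (isClosed_eq (differentiable_heckeEq m).continuous continuous_const).closure_subset_iff.mpr
        hsub (mem_closure_inter hw h)
  reduced := by
    rintro w ⟨hw, h⟩
    refine closure_mono ?_ (mem_closure_inter hw h)
    rintro u ⟨hu, hu'⟩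
    obtain ⟨h0, h1⟩ := (mem_chartHecke_iff_of_mem_heckeNhd hm hu).mp hu'
    exact ⟨hu, h1, fderiv_heckeEq_ne_zero h0 (norm_lt_one_of_mem_heckeNhd hu) h1⟩

/-! ## Growth of `Ξ + log |f|²` -/

/-- Since `y₁ ≥ y₂`, each factor is at most `2|q₂| ≤ 1`, so one factor bounds the whole product. -/
lemma log_norm_heckeEq_le {m : ℤ} (hm : 0 < m) {A : ℝ} (hAm : (m : ℝ) ≤ A)
    {z : Fin 2 → UpperHalfPlane} (hz : (z 0).im = A * (z 1).im)
    (hW : qCoord z ∈ heckeNhd m) (h0 : heckeEq m (qCoord z) ≠ 0) :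
    Real.log (‖heckeEq m (qCoord z)‖ ^ 2) ≤ 2 * Real.log 2 - 4 * Real.pi * (z 1).im := by
  have hπ := Real.pi_gt_three
  have hy := (z 1).im_pos
  have hq := norm_lt_one_of_mem_heckeNhd hW
  have hy1 : 1 ≤ (z 1).im := by
    have := qCoord_mem_heckeNhd.mp hW 1
    linarith [abs_nonneg (m : ℝ)]
  have hbase : ‖qCoord z 1‖ ≤ 1 / 2 := by
    rw [norm_qCoord]
    calc Real.exp (-(2 * Real.pi * (z 1).im)) ≤ Real.exp (-1) := Real.exp_le_exp.mpr (by nlinarith)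
      _ ≤ 1 / 2 := by
        rw [Real.exp_neg, one_div]
        exact inv_anti₀ two_pos (by linarith [Real.add_one_le_exp 1])
  have hfac : ∀ p ∈ m.toNat.divisorsAntidiagonal,
      ‖qCoord z 0 ^ p.1 - qCoord z 1 ^ p.2‖ ≤ 2 * ‖qCoord z 1‖ := by
    intro p hp
    obtain ⟨hd, ha, hpm⟩ := mem_divisorsAntidiagonal_toNat hp
    have hm1 : (1 : ℝ) ≤ m := by exact_mod_cast hm
    have h1 : ‖qCoord z 0 ^ p.1‖ ≤ ‖qCoord z 1‖ := by
      rw [norm_pow]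
      refine (pow_le_of_le_one (norm_nonneg _) (hq 0).le hd.ne').trans ?_
      rw [norm_qCoord, norm_qCoord, hz, Real.exp_le_exp, neg_le_neg_iff]
      gcongr
      exact le_mul_of_one_le_left hy.le (by linarith)
    have h2 : ‖qCoord z 1 ^ p.2‖ ≤ ‖qCoord z 1‖ := by
      rw [norm_pow]
      exact pow_le_of_le_one (norm_nonneg _) (hq 1).le ha.ne'
    linarith [norm_sub_le (qCoord z 0 ^ p.1) (qCoord z 1 ^ p.2)]
  have hle : ‖heckeEq m (qCoord z)‖ ≤ 2 * ‖qCoord z 1‖ := by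
    have hm0 : m.toNat ≠ 0 := by omega
    have hmem : ((1, m.toNat) : ℕ × ℕ) ∈ m.toNat.divisorsAntidiagonal := by simp [hm0]
    rw [heckeEq, norm_prod, ← Finset.mul_prod_erase _ _ hmem]
    refine (mul_le_of_le_one_right (norm_nonneg _) (Finset.prod_le_one (fun _ _ => norm_nonneg _)
      fun p hp => ?_)).trans (hfac _ hmem)
    linarith [hfac p (Finset.mem_of_mem_erase hp)]
  have hpos : 0 < ‖heckeEq m (qCoord z)‖ := norm_pos_iff.mpr h0
  have hlog := Real.log_le_log hpos hle
  rw [Real.log_mul two_ne_zero (norm_ne_zero_iff.mpr (qCoord_ne_zero z 1)), norm_qCoord,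
    Real.log_exp] at hlog
  rw [Real.log_pow]
  push_cast
  linarith

/-- On the ray `√(y₁y₂) = √A y₂`, so the last bound makes the linear growth of `Ξ` at most `πy₂`,
against the `4πy₂` from `log |f|²`. It is attainable because `cuspConst` does not depend on `A`. -/
lemma exists_slope {v : ℝ} (hv : 0 < v) (m : ℤ) : ∃ A : ℝ, 1 ≤ A ∧ 4 * |(m : ℝ)| ≤ A ∧
    1 ≤ Real.pi * v * (A / 4) ∧
    cuspConst v m * Real.exp (-(Real.pi * v * (A / 4))) * √A ≤ Real.pi := by
  have hπ := Real.pi_pos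
  have hlim : Tendsto (fun A : ℝ => cuspConst v m * (A * Real.exp (-(Real.pi * v / 4) * A))) atTop
      (𝓝 (cuspConst v m * 0)) := by
    refine Tendsto.const_mul _ ?_
    have := tendsto_rpow_mul_exp_neg_mul_atTop_nhds_zero 1 (Real.pi * v / 4) (by positivity)
    simpa using this
  rw [mul_zero] at hlim
  obtain ⟨A, h1, h2, h3, h4⟩ := ((hlim.eventually (gt_mem_nhds hπ)).and
    ((eventually_ge_atTop 1).and ((eventually_ge_atTop (4 * |(m : ℝ)|)).and
      (eventually_ge_atTop (4 / (Real.pi * v)))))).exists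
  refine ⟨A, h2, h3, ?_, le_trans ?_ h1.le⟩
  · rw [div_le_iff₀ (by positivity)] at h4
    linarith
  · have hs : √A ≤ A := Real.sqrt_le_iff.mpr ⟨by linarith, by nlinarith⟩
    have hc : 0 ≤ cuspConst v m := by unfold cuspConst; positivity
    calc _ ≤ cuspConst v m * Real.exp (-(Real.pi * v * (A / 4))) * A := by gcongr
      _ = _ := by
        rw [show -(Real.pi * v / 4) * A = -(Real.pi * v * (A / 4)) by ring]
        ring

lemma sqrt_im_mul_im {A : ℝ} (hA : 0 ≤ A) {z : Fin 2 → UpperHalfPlane}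
    (hz : (z 0).im = A * (z 1).im) : √((z 0).im * (z 1).im) = √A * (z 1).im := by
  rw [hz, mul_assoc, Real.sqrt_mul hA, Real.sqrt_mul_self (z 1).im_pos.le]

theorem growth_of_pos {v : ℝ} (hv : 0 < v) {m : ℤ} (hm : 0 < m) :
    ∃ a > (0 : ℝ), ∃ c > (0 : ℝ), ∃ T : ℝ, ∀ z : Fin 2 → UpperHalfPlane,
      (z 0).im = a * (z 1).im → T ≤ (z 1).im →
        qCoord z ∈ heckeNhd m ∧ z ∉ heckeSet m ∧
        c * √((z 0).im * (z 1).im) ≤ |Xi v m z + Real.log (‖heckeEq m (qCoord z)‖ ^ 2)| := by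
  have hπ := Real.pi_pos
  obtain ⟨A, hA, hAm, hAv, hAc⟩ := exists_slope hv m
  obtain ⟨K, hK⟩ := Xi_le hv hm.ne' hA hAm hAv
  have hA0 : 0 < A := by linarith
  have hpv : 0 < 1 / (Real.pi * v) := by positivity
  have hm0 := abs_nonneg (m : ℝ)
  refine ⟨A, hA0, Real.pi / √A, by positivity,
    -- The second entry lets `y₂` absorb the constants: the sum is at most `-3πy₂ + y₂ ≤ -πy₂`.
    max (1 + 2 * |(m : ℝ)| + 1 / (Real.pi * v) + v) (|K| + 2 * Real.log 2), fun z hz hT => ?_⟩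
  have hT1 := (le_max_left _ _).trans hT
  have hT2 := (le_max_right _ _).trans hT
  have hnot := not_mem_heckeSet_of_large hv hm.ne' hA hAm hz (by linarith)
  have him : ∀ i, |(m : ℝ)| + 1 < (z i).im := by
    rw [Fin.forall_fin_two]
    have h1 : |(m : ℝ)| + 1 < (z 1).im := by linarith
    refine ⟨h1.trans_le ?_, h1⟩
    rw [hz]
    exact le_mul_of_one_le_left (z 1).im_pos.le hA
  have hW := qCoord_mem_heckeNhd.mpr him
  refine ⟨hW, hnot, ?_⟩
  have h1 := hK z hz hT1
  have h2 := log_norm_heckeEq_le hm (by linarith [le_abs_self (m : ℝ)]) hz hW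
    fun h => hnot ((mem_heckeSet_iff_heckeEq hm.ne' him).mpr h)
  rw [sqrt_im_mul_im hA0.le hz] at h1 ⊢
  have h3 : cuspConst v m * Real.exp (-(Real.pi * v * (A / 4))) * (√A * (z 1).im) ≤
      Real.pi * (z 1).im := by
    rw [← mul_assoc]
    exact mul_le_mul_of_nonneg_right hAc (z 1).im_pos.le
  have h4 : Real.pi / √A * (√A * (z 1).im) = Real.pi * (z 1).im := by
    field_simp
  rw [h4]
  refine le_trans ?_ (neg_le_abs _)
  have := le_abs_self K
  have := Real.pi_gt_three
  have := (z 1).im_pos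
  nlinarith

theorem growth_of_neg {v : ℝ} (hv : 0 < v) {m : ℤ} (hm : m < 0) :
    ∃ a > (0 : ℝ), ∃ c > (0 : ℝ), ∃ T : ℝ, ∀ z : Fin 2 → UpperHalfPlane,
      (z 0).im = a * (z 1).im → T ≤ (z 1).im →
        qCoord z ∈ heckeNhd m ∧ z ∉ heckeSet m ∧
        c * √((z 0).im * (z 1).im) ≤ |Xi v m z + Real.log (‖heckeEq m (qCoord z)‖ ^ 2)| := by
  have hπ := Real.pi_pos
  have hm0 := abs_nonneg (m : ℝ)
  refine ⟨1, one_pos, 1 / 2 * negEiNeg (Real.pi * v * (1 + (m - 1 : ℝ) ^ 2)),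
    mul_pos (by norm_num) (negEiNeg_pos (by positivity)), |(m : ℝ)| + 2, fun z hz hT => ?_⟩
  have hz' : (z 0).im = (z 1).im := by rw [hz, one_mul]
  refine ⟨qCoord_mem_heckeNhd.mpr ?_, not_mem_heckeSet_of_neg hm z, ?_⟩
  · rw [Fin.forall_fin_two, hz']
    constructor <;> linarith
  -- For `m < 0`, `m.toNat = 0` and the product is empty.
  · have hf : heckeEq m (qCoord z) = 1 := by
      rw [heckeEq, Int.toNat_of_nonpos hm.le, Nat.divisorsAntidiagonal_zero, Finset.prod_empty]
    rw [hf, sqrt_im_mul_im zero_le_one hz]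
    simp only [Real.sqrt_one, one_mul, norm_one, one_pow, Real.log_one, add_zero]
    exact (le_Xi_of_neg hv hm hz' (by linarith)).trans (le_abs_self _)

theorem growth {v : ℝ} (hv : 0 < v) {m : ℤ} (hm : m ≠ 0) :
    ∃ a > (0 : ℝ), ∃ c > (0 : ℝ), ∃ T : ℝ, ∀ z : Fin 2 → UpperHalfPlane,
      (z 0).im = a * (z 1).im → T ≤ (z 1).im →
        qCoord z ∈ heckeNhd m ∧ z ∉ heckeSet m ∧
        c * √((z 0).im * (z 1).im) ≤ |Xi v m z + Real.log (‖heckeEq m (qCoord z)‖ ^ 2)| :=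
  hm.lt_or_gt.elim (growth_of_neg hv) (growth_of_pos hv)

/-! ## The obstruction -/

/-- A power of `log log (1 / |q₁|) · log log (1 / |q₂|)` does not dominate `√(y₁ y₂)`. -/
lemma not_eventually_le {a c : ℝ} (ha : 0 < a) (hc : 0 < c) (C : ℝ) (M : ℕ) :
    ¬ ∀ᶠ y : ℝ in atTop, c * (√a * y) ≤
      C * (Real.log (2 * Real.pi * (a * y)) ^ M * Real.log (2 * Real.pi * y) ^ M) := by
  intro h
  have hπ := Real.pi_pos
  have ho := Real.isLittleO_pow_log_id_atTop (n := 2 * M)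
  -- Chosen so that the logarithmic side is at most half of `c √a y`; the `4 ^ M` comes from `log (k
  -- y) ≤ 2 log y` for `y ≥ k`, used twice.
  have hε : 0 < c * √a / (2 * ((|C| + 1) * 4 ^ M)) := by positivity
  obtain ⟨y, h1, h2, h3, h4, h5⟩ := (h.and ((ho.def hε).and ((eventually_ge_atTop 1).and
    ((eventually_ge_atTop (max (2 * Real.pi * a) (2 * Real.pi))).and
      (eventually_ge_atTop (max (1 / (2 * Real.pi * a)) 1)))))).exists
  have hy : 0 < y := by linarith
  have hb : ∀ k : ℝ, 0 < k → 1 ≤ k * y → k ≤ y →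
      0 ≤ Real.log (k * y) ∧ Real.log (k * y) ≤ 2 * Real.log y := by
    intro k hk hk1 hky
    refine ⟨Real.log_nonneg hk1, ?_⟩
    have : Real.log (k * y) ≤ Real.log (y ^ 2) :=
      Real.log_le_log (by positivity) (by nlinarith)
    rwa [Real.log_pow, Nat.cast_ofNat] at this
  have ha1 := hb (2 * Real.pi * a) (by positivity) (by
    have := (le_max_left _ _).trans h5
    rwa [div_le_iff₀ (by positivity), mul_comm] at this) ((le_max_left _ _).trans h4)
  have hb1 := hb (2 * Real.pi) (by positivity)
    (by nlinarith [Real.pi_gt_three]) ((le_max_right _ _).trans h4)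
  rw [mul_assoc (2 * Real.pi)] at ha1
  have hl : 0 ≤ Real.log y := Real.log_nonneg h3
  have h6 : Real.log (2 * Real.pi * (a * y)) ^ M * Real.log (2 * Real.pi * y) ^ M ≤
      4 ^ M * Real.log y ^ (2 * M) := by
    calc _ ≤ (2 * Real.log y) ^ M * (2 * Real.log y) ^ M :=
          mul_le_mul (pow_le_pow_left₀ ha1.1 ha1.2 M) (pow_le_pow_left₀ hb1.1 hb1.2 M)
            (pow_nonneg hb1.1 M) (by positivity)
      _ = _ := by rw [← mul_pow, pow_mul, ← mul_pow]; congr 1; ring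
  have h7 : 0 ≤ Real.log (2 * Real.pi * (a * y)) ^ M * Real.log (2 * Real.pi * y) ^ M :=
    mul_nonneg (pow_nonneg ha1.1 M) (pow_nonneg hb1.1 M)
  rw [Real.norm_of_nonneg (by positivity), id, Real.norm_of_nonneg hy.le] at h2
  have h8 : c * (√a * y) ≤ (|C| + 1) * (4 ^ M * Real.log y ^ (2 * M)) :=
    h1.trans (mul_le_mul (by linarith [le_abs_self C]) h6 h7 (by positivity))
  have h9 : (|C| + 1) * (4 ^ M * Real.log y ^ (2 * M)) ≤ c * √a * y / 2 := by
    calc _ = ((|C| + 1) * 4 ^ M) * Real.log y ^ (2 * M) := by ring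
      _ ≤ ((|C| + 1) * 4 ^ M) * (c * √a / (2 * ((|C| + 1) * 4 ^ M)) * y) := by gcongr
      _ = _ := by field_simp
  have : 0 < c * √a * y := by positivity
  linarith

/-- The point `(i a y, i y)`. -/
noncomputable def rayPoint {a : ℝ} (ha : 0 < a) {y : ℝ} (hy : 0 < y) : Fin 2 → UpperHalfPlane :=
  ![⟨⟨0, a * y⟩, mul_pos ha hy⟩, ⟨⟨0, y⟩, hy⟩]

lemma rayPoint_im_zero {a : ℝ} (ha : 0 < a) {y : ℝ} (hy : 0 < y) :
    (rayPoint ha hy 0).im = a * y := rfl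

lemma rayPoint_im_one {a : ℝ} (ha : 0 < a) {y : ℝ} (hy : 0 < y) :
    (rayPoint ha hy 1).im = y := rfl

lemma eventually_rayPoint {a : ℝ} (ha : 0 < a) {P : (Fin 2 → ℂ) → Prop} (S : Finset (Fin 2))
    (h : ∀ᶠ w in 𝓝[(chartBoundary S)ᶜ] 0, P w) :
    ∀ᶠ y : ℝ in atTop, ∀ hy : 0 < y, P (qCoord (rayPoint ha hy)) := by
  have hπ := Real.pi_pos
  obtain ⟨ε, hε, hP⟩ := Metric.mem_nhdsWithin_iff.mp h
  have hlim : ∀ k : ℝ, 0 < k → ∀ᶠ y : ℝ in atTop, Real.exp (-(2 * Real.pi * (k * y))) < ε := by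
    intro k hk
    have : Tendsto (fun y : ℝ => Real.exp (-(2 * Real.pi * (k * y)))) atTop (𝓝 0) := by
      refine Real.tendsto_exp_neg_atTop_nhds_zero.comp ?_
      exact (tendsto_id.const_mul_atTop hk).const_mul_atTop (by positivity)
    exact this.eventually (gt_mem_nhds hε)
  filter_upwards [hlim a ha, hlim 1 one_pos] with y h0 h1 hy
  refine hP ⟨?_, fun ⟨i, _, hi⟩ => qCoord_ne_zero _ i hi⟩
  rw [mem_ball_zero_iff, pi_norm_lt_iff hε, Fin.forall_fin_two, norm_qCoord, norm_qCoord,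
    rayPoint_im_zero, rayPoint_im_one]
  exact ⟨h0, by simpa using h1⟩

/-- No function with log-log growth at `(∞, ∞)` agrees with `Ξ + log |f|²` off the boundary. -/
theorem not_logLogGrowthAt {v : ℝ} (hv : 0 < v) {m : ℤ} (hm : m ≠ 0) {g : X → ℝ}
    (hg : IsDescentOfXi v m g) {h : (Fin 2 → ℂ) → ℝ}
    (hgh : ∀ w ∈ heckeNhd m, w ∉ chartBoundary Finset.univ → heckeEq m w ≠ 0 →
      g (chart Finset.univ w) = -Real.log (‖heckeEq m w‖ ^ 2) + h w) :
    ¬ LogLogGrowthAt Finset.univ 0 (fun w => (h w : ℂ)) := by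
  rintro ⟨C, M, hCM⟩
  obtain ⟨a, ha, c, hc, T, hT⟩ := growth hv hm
  refine not_eventually_le ha hc C M ?_
  filter_upwards [eventually_rayPoint ha _ hCM, eventually_ge_atTop T, eventually_gt_atTop 0]
    with y h1 h2 hy
  obtain ⟨hW, hnot, hle⟩ := hT (rayPoint ha hy) rfl h2
  have hval := hgh _ hW (fun ⟨i, _, hi⟩ => qCoord_ne_zero _ i hi) fun hf =>
    hnot ((mem_heckeSet_iff_heckeEq hm (qCoord_mem_heckeNhd.mp hW)).mpr hf)
  rw [chart_qCoord, hg _ hnot] at hval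
  rw [hval, sqrt_im_mul_im ha.le rfl, rayPoint_im_one, neg_add_cancel_comm] at hle
  refine hle.trans ?_
  have := h1 hy
  simpa [cuspsAt, Fin.prod_univ_two, norm_qCoord, rayPoint_im_zero, rayPoint_im_one,
    Real.exp_neg] using this

theorem not_isLogLogGreen {v : ℝ} (hv : 0 < v) {m : ℤ} (hm : m ≠ 0) {g : X → ℝ}
    (hg : IsDescentOfXi v m g) : ¬ IsLogLogGreen m g := by
  intro hG
  obtain ⟨h, hh, hgh⟩ := hG _ _ _ (isLocalEquation_heckeEq hm)
  exact not_logLogGrowthAt hv hm hg hgh (hh.growth 0 (zero_mem_heckeNhd m))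

theorem not_isGreen {v : ℝ} (hv : 0 < v) {m : ℤ} (hm : m ≠ 0) {g : X → ℝ}
    (hg : IsDescentOfXi v m g) : ¬ IsGreen m g := by
  intro hG
  obtain ⟨h, hh, hgh⟩ := hG _ _ _ (isLocalEquation_heckeEq hm)
  -- A smooth extension is bounded near `(∞, ∞)`, which is log-log growth with exponent `0`.
  refine not_logLogGrowthAt hv hm hg (fun w hw _ hf => hgh w hw hf) ⟨|h 0| + 1, 0, ?_⟩
  have hcont : ContinuousAt h 0 := (hh.continuousOn.continuousAt
    ((isOpen_heckeNhd m).mem_nhds (zero_mem_heckeNhd m)))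
  have hev : ∀ᶠ w in 𝓝 (0 : Fin 2 → ℂ), |h w| < |h 0| + 1 :=
    hcont.abs.eventually (gt_mem_nhds (by linarith))
  filter_upwards [nhdsWithin_le_nhds hev] with w hw
  simpa using hw.le

end KudlaGreen

theorem mainTheorem11 (v : ℝ) (hv : 0 < v) (m : ℤ) (hm : m ≠ 0) :
    -- the series converges off `T(m)` and `Ξ(v, ·, m)` is a function on `X ∖ (D ∪ T(m))`
    (∀ z, z ∉ KudlaGreen.heckeSet m → Summable fun M : KudlaGreen.L m =>
      KudlaGreen.negEiNeg (2 * Real.pi * v * KudlaGreen.R z M.1)) ∧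
    (∃ g : KudlaGreen.X → ℝ, KudlaGreen.IsDescentOfXi v m g) ∧
    -- it is not a Green function in the sense of Gillet and Soulé
    (¬ ∃ g : KudlaGreen.X → ℝ, KudlaGreen.IsDescentOfXi v m g ∧ KudlaGreen.IsGreen m g) ∧
    -- it is not a Green function with log-log singularities
    (¬ ∃ g : KudlaGreen.X → ℝ, KudlaGreen.IsDescentOfXi v m g ∧ KudlaGreen.IsLogLogGreen m g) ∧
    -- the obstruction: growth of order `t = √(y₁ y₂)` at the point `(∞, ∞)`
    (∃ (W : Set (Fin 2 → ℂ)) (f : (Fin 2 → ℂ) → ℂ), (0 : Fin 2 → ℂ) ∈ W ∧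
      KudlaGreen.IsLocalEquation m Finset.univ W f ∧
      ∃ a > (0 : ℝ), ∃ c > (0 : ℝ), ∃ T : ℝ, ∀ z : Fin 2 → UpperHalfPlane,
        (z 0).im = a * (z 1).im → T ≤ (z 1).im →
          KudlaGreen.qCoord z ∈ W ∧ z ∉ KudlaGreen.heckeSet m ∧
          c * Real.sqrt ((z 0).im * (z 1).im) ≤
            |KudlaGreen.Xi v m z + Real.log (‖f (KudlaGreen.qCoord z)‖ ^ 2)|) := by
  refine ⟨fun z _ => KudlaGreen.summable_negEiNeg hv m z, KudlaGreen.exists_descent v m,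
    fun ⟨g, hg, hG⟩ => KudlaGreen.not_isGreen hv hm hg hG,
    fun ⟨g, hg, hG⟩ => KudlaGreen.not_isLogLogGreen hv hm hg hG,
    KudlaGreen.heckeNhd m, KudlaGreen.heckeEq m, KudlaGreen.zero_mem_heckeNhd m,
    KudlaGreen.isLocalEquation_heckeEq hm, KudlaGreen.growth hv hm⟩
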